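/- **Setting.** Let $m\ge 1$ agents be the nodes of a connected graph $\mathcal G$. Let $g:\mathbb R^{n_1}\to\mathbb R\cup\{+\infty\}$ and $h:\mathbb R^{n_2}\to\mathbb R\cup\{+\infty\}$ be closed convex functions, where $\mathrm{dom}(h)$ has nonempty relative interior, and let $f_1,\dots,f_m$ be real functions of $(\mathbf x,\mathbf y)\in\mathbb R^{n_1}\times\mathbb R^{n_2}$. Let $0<\mu\le L$ and $\kappa=L/\mu$. Assume that each $f_i$ is differentiable with $L$-Lipschitz gradient on an open set $\mathcal Z\supseteq\mathrm{dom}(g)\times\mathrm{dom}(h)$ and that $\langle \mathbf y-\tilde{\mathbf y},\nabla_{\mathbf y}f_i(\mathbf x,\mathbf y)-\nabla_{\mathbf y}f_i(\mathbf x,\tilde{\mathbf y})\rangle\le-\mu\|\mathbf y-\tilde{\mathbf y}\|^2$ for all $\mathbf x\in\mathrm{dom}(g)$ and $\mathbf y,\tilde{\mathbf y}\in\mathrm{dom}(h)$. Let $p(\mathbf x)=\max_{\mathbf y}\{\frac1m\sum_i f_i(\mathbf x,\mathbf y)-h(\mathbf y)\}$ and assume that $p+g$ has a minimizer $\mathbf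 x^*$. Let $\mathbf W=(w_{ij})\in\mathbb R^{m\times m}$ satisfy: $w_{ij}=0$ if $i\ne j$ are not adjacent in $\mathcal G$; $\rho:=\|\mathbf W-\frac1m\mathbf 1\mathbf 1^\top\|_2<1$; $\mathrm{Null}(\mathbf W-\mathbf I)=\mathrm{Span}\{\mathbf 1\}$; $\mathbf W^\top\mathbf 1=\mathbf 1$; $\|\mathbf W-\mathbf I\|_2\le2$. Matrices $\mathbf X\in\mathbb R^{m\times n_1}$ and $\mathbf Y,\mathbf\Lambda\in\mathbb R^{m\times n_2}$ have rows $\mathbf x_i$, $\mathbf y_i$, $\boldsymbol\lambda_i$; write $\mathbf x_{\rm avg}=\frac1m\sum_i\mathbf x_i$ and $\mathbf X_\perp=\mathbf X-\mathbf 1\mathbf x_{\rm avg}^\top$. Let $$\Phi(\mathbf X,\mathbf\Lambda,\mathbf Y)=\tfrac1m\sum_{i=1}^m\big(f_i(\mathbf x_i,\mathbf y_i)-h(\mathbf y_i)\big)-\tfrac{L}{2\sqrt m}\langle\mathbf\Lambda,(\mathbf W-\mathbf I)\mathbf Y\rangle,$$ $$P(\mathbf x,\mathbf\Lambda)=\max_{\mathbf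 Y}\Phi(\mathbf 1\mathbf x^\top,\mathbf\Lambda,\mathbf Y),\qquad \phi(\mathbf x,\mathbf\Lambda)=P(\mathbf x,\mathbf\Lambda)+g(\mathbf x).$$ The reformulated problem is $\min_{\mathbf X,\mathbf\Lambda}\max_{\mathbf Y}\Phi(\mathbf X,\mathbf\Lambda,\mathbf Y)+\frac1m\sum_i g(\mathbf x_i)$ subject to $\mathbf x_i=\mathbf x_j$ for all edges $(i,j)$. Here $\nabla_{\mathbf x}P$ is the gradient of $P(\cdot,\mathbf\Lambda)$ as a function on $\mathrm{dom}(g)$, and $\mathrm{prox}_r(\mathbf u)=\arg\min_{\mathbf z}\{r(\mathbf z)+\frac12\|\mathbf z-\mathbf u\|^2\}$. **Algorithm (D-GDMax).** Given $\mathbf x^0\in\mathrm{dom}(g)$, stepsizes $\eta_x,\eta_\lambda>0$ and tolerances $\delta_t\ge0$, start with $\mathbf x_i^0=\mathbf x^0$, $\boldsymbol\lambda_i^0=\mathbf 0$ and $\mathbf v_i^0=\nabla_{\mathbf x}f_i(\mathbf x_i^0,\mathbf y_i^0)$. For every $t\ge0$, $\mathbf y_i^t$ is any point with $\mathrm{dist}(\mathbf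 0,\partial d_i^t(\mathbf y_i^t))\le\delta_t$, where $d_i^t(\mathbf y)=f_i(\mathbf x_i^t,\mathbf y)-h(\mathbf y)-\frac{L\sqrt m}2\langle\tilde{\boldsymbol\lambda}_i^t,\mathbf y\rangle$ and $\tilde{\boldsymbol\lambda}_i^t=\sum_j w_{ji}\boldsymbol\lambda_j^t-\boldsymbol\lambda_i^t$. The updates are $$\mathbf x_i^{t+1}=\mathrm{prox}_{\eta_xg}\Big(\sum_jw_{ij}\mathbf x_j^t-\eta_x\mathbf v_i^t\Big),\qquad \boldsymbol\lambda_i^{t+1}=\boldsymbol\lambda_i^t+\tfrac{L\eta_\lambda}{2\sqrt m}\Big(\sum_jw_{ij}\mathbf y_j^t-\mathbf y_i^t\Big),$$ $$\mathbf v_i^{t+1}=\sum_jw_{ij}\mathbf v_j^t+\nabla_{\mathbf x}f_i(\mathbf x_i^{t+1},\mathbf y_i^{t+1})-\nabla_{\mathbf x}f_i(\mathbf x_i^t,\mathbf y_i^t).$$ **Theorem.** Let $\varepsilon>0$, and let $(\mathbf X^t,\mathbf\Lambda^t)$ be generated by D-GDMax with $$\eta_x=\frac{(1-\rho)^2}{5L\sqrt{1+6\kappa^2}},\qquad\eta_\lambda=\frac{(1-\rho)^2}{L(9\kappa+2)}.$$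 Suppose that $\delta_t\le\frac{(1-\rho)^2}{8\kappa(1+t)}$ for all $t\ge0$ and $\|\mathbf V_\perp^0\|_F^2\le2mL\kappa(1-\rho)$. Put $\phi_0=\phi(\mathbf x_{\rm avg}^0,\mathbf\Lambda^0)-(p+g)(\mathbf x^*)$ and $$T=\left\lceil\frac1{\varepsilon^2}\max\left\{\frac{64\big(10L\kappa(\phi_0+1)+1\big)}{(1-\rho)^2},\ \frac{4096L\kappa}{1-\rho},\ 800\right\}\right\rceil .$$ Let $\tau$ be uniformly distributed on $\{0,\dots,T-1\}$. Then $P$ has the gradients below at the iterates $(\mathbf x^t_{\rm avg},\mathbf\Lambda^t)$, $0\le t<T$, and $(\mathbf X^\tau,\mathbf\Lambda^\tau)$ is an $\varepsilon$-stationary point of the reformulated problem in expectation, that is, $$\frac1{\eta_x}\mathbb E_\tau\Big\|\mathbf x_{\rm avg}^\tau-\mathrm{prox}_{\eta_xg}\big(\mathbf x_{\rm avg}^\tau-\eta_x\nabla_{\mathbf x}P(\mathbf x_{\rm avg}^\tau,\mathbf\Lambda^\tau)\big)\Big\|\le\varepsilon,$$ $$\frac L{\sqrt m}\mathbb E_\tau\|\mathbf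 X_\perp^\tau\|_F\le\varepsilon,\qquad \mathbb E_\tau\|\nabla_{\mathbf\Lambda}P(\mathbf x_{\rm avg}^\tau,\mathbf\Lambda^\tau)\|_F\le\varepsilon .$$ (If $\mathrm{dom}(g)$ has empty interior, so that $\nabla_{\mathbf x}P$ relative to $\mathrm{dom}(g)$ is not unique, the first bound holds for every choice of it.) -/

import Mathlib

noncomputable section

namespace DGDMax

/-- The Euclidean space `ℝⁿ`. -/
abbrev Vec (n : ℕ) : Type := EuclideanSpace ℝ (Fin n)

/-- Real `m × n` matrices, stored by rows (row `i` belongs to agent `i`), with the Frobenius inner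
product and the Frobenius norm. -/
abbrev Stack (m n : ℕ) : Type := PiLp 2 (fun _ : Fin m => Vec n)

/-- `ℝ^{n₁} × ℝ^{n₂}` with the Euclidean norm of the concatenated vector `[x; y]`. -/
abbrev PairVec (n₁ n₂ : ℕ) : Type := WithLp 2 (Vec n₁ × Vec n₂)

/-- The concatenation `[x; y]`. -/
def pair {n₁ n₂ : ℕ} (x : Vec n₁) (y : Vec n₂) : PairVec n₁ n₂ := WithLp.toLp 2 (x, y)

/-! ### Extended-valued convex functions -/

/-- The effective domain of an extended-valued function. -/
def dom {n : ℕ} (r : Vec n → EReal) : Set (Vec n) := {x | r x < ⊤}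

/-- `r : ℝⁿ → ℝ ∪ {+∞}` is closed and convex: its value is never `-∞`, its epigraph is convex
and it is lower semicontinuous. -/
def IsClosedConvex {n : ℕ} (r : Vec n → EReal) : Prop :=
  (∀ x, r x ≠ ⊥) ∧
  Convex ℝ {q : Vec n × ℝ | r q.1 ≤ (q.2 : EReal)} ∧
  LowerSemicontinuous r

/-- The proximal mapping `prox_r(u) = argmin_z { r(z) + ½ ‖z - u‖² }`. -/
def prox {n : ℕ} (r : Vec n → EReal) (u : Vec n) : Vec n :=
  Classical.epsilon fun z : Vec n =>
    IsMinOn (fun w => r w + ((‖w - u‖ ^ 2 / 2 : ℝ) : EReal)) Set.univ z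

/-- The scaled function `η r`. -/
def scale {n : ℕ} (η : ℝ) (r : Vec n → EReal) : Vec n → EReal := fun z => (η : EReal) * r z

/-- The subdifferential `∂d(y)` of a concave extended-valued function `d` (the set of its
supergradients). -/
def superdifferential {n : ℕ} (d : Vec n → EReal) (y : Vec n) : Set (Vec n) :=
  {ξ | ∀ y', d y' ≤ d y + ((inner ℝ ξ (y' - y) : ℝ) : EReal)}

/-! ### Row-wise matrix operations -/

/-- The matrix product `A X`, row by row. -/
def matMul {m n : ℕ} (A : Matrix (Fin m) (Fin m) ℝ) (X : Stack m n) : Stack m n :=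
  WithLp.toLp 2 fun i => ∑ j, A i j • X j

/-- The average `x_avg` of the rows of `X`. -/
def avg {m n : ℕ} (X : Stack m n) : Vec n := (1 / (m : ℝ)) • ∑ i, X i

/-- `𝟏 xᵀ`: the matrix all of whose rows are `x`. -/
def rep (m : ℕ) {n : ℕ} (x : Vec n) : Stack m n := WithLp.toLp 2 fun _ => x

/-- The consensus error `X_⊥ = X - 𝟏 x_avgᵀ`. -/
def perp {m n : ℕ} (X : Stack m n) : Stack m n := X - rep m (avg X)

/-- The spectral norm `‖A‖₂`. -/
def specNorm {m : ℕ} (A : Matrix (Fin m) (Fin m) ℝ) : ℝ :=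
  ‖Matrix.toEuclideanCLM (n := Fin m) (𝕜 := ℝ) A‖

/-- `ρ = ‖W - (1/m) 𝟏𝟏ᵀ‖₂`. -/
def rho {m : ℕ} (W : Matrix (Fin m) (Fin m) ℝ) : ℝ :=
  specNorm (W - Matrix.of fun _ _ => 1 / (m : ℝ))

/-- The conditions on the mixing matrix `W` of the graph `G`. -/
structure IsMixing {m : ℕ} (G : SimpleGraph (Fin m)) (W : Matrix (Fin m) (Fin m) ℝ) : Prop where
  support : ∀ i j, i ≠ j → ¬ G.Adj i j → W i j = 0
  rho_lt_one : rho W < 1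
  ker_sub_one : LinearMap.ker (Matrix.toLin' (W - 1)) = Submodule.span ℝ {fun _ => (1 : ℝ)}
  transpose_mulVec_one : Matrix.mulVec W.transpose (fun _ => (1 : ℝ)) = fun _ => 1
  norm_sub_one_le : specNorm (W - 1) ≤ 2

/-! ### The objective functions -/

/-- The partial gradient `∇ₓ f(x, y)`. -/
def gradX {n₁ n₂ : ℕ} (f : PairVec n₁ n₂ → ℝ) (x : Vec n₁) (y : Vec n₂) : Vec n₁ :=
  gradient (fun x' => f (pair x' y)) x

/-- The partial gradient `∇_y f(x, y)`. -/
def gradY {n₁ n₂ : ℕ} (f : PairVec n₁ n₂ → ℝ) (x : Vec n₁) (y : Vec n₂) : Vec n₂ :=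
  gradient (fun y' => f (pair x y')) y

/-- `f` is `L`-smooth in `Z`: differentiable there, with an `L`-Lipschitz gradient. -/
def IsSmoothOn {n₁ n₂ : ℕ} (f : PairVec n₁ n₂ → ℝ) (L : ℝ) (Z : Set (PairVec n₁ n₂)) : Prop :=
  (∀ z ∈ Z, DifferentiableAt ℝ f z) ∧
  ∀ z ∈ Z, ∀ z' ∈ Z, ‖gradient f z - gradient f z'‖ ≤ L * ‖z - z'‖

/-- `f(x, ·)` is `μ`-strongly concave on `D₂` for every `x ∈ D₁`. -/
def IsStronglyConcaveIn {n₁ n₂ : ℕ} (f : PairVec n₁ n₂ → ℝ) (μ : ℝ)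
    (D₁ : Set (Vec n₁)) (D₂ : Set (Vec n₂)) : Prop :=
  ∀ x ∈ D₁, ∀ y ∈ D₂, ∀ y' ∈ D₂,
    inner ℝ (y - y') (gradY f x y - gradY f x y') ≤ -μ * ‖y - y'‖ ^ 2

/-- `p(x) = max_y { (1/m) ∑ᵢ fᵢ(x, y) - h(y) }`. -/
def primal {m n₁ n₂ : ℕ} (f : Fin m → PairVec n₁ n₂ → ℝ) (h : Vec n₂ → EReal)
    (x : Vec n₁) : EReal :=
  ⨆ y : Vec n₂, (((1 / (m : ℝ)) * ∑ i, f i (pair x y) : ℝ) : EReal) - h y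

/-- `Φ(X, Λ, Y) = (1/m) ∑ᵢ (fᵢ(xᵢ, yᵢ) - h(yᵢ)) - L/(2√m) ⟨Λ, (W - I) Y⟩`. -/
def bigPhi {m n₁ n₂ : ℕ} (f : Fin m → PairVec n₁ n₂ → ℝ) (h : Vec n₂ → EReal)
    (W : Matrix (Fin m) (Fin m) ℝ) (L : ℝ)
    (X : Stack m n₁) (Λ : Stack m n₂) (Y : Stack m n₂) : EReal :=
  ((1 / (m : ℝ) : ℝ) : EReal) * ∑ i, ((f i (pair (X i) (Y i)) : EReal) - h (Y i))
    - ((L / (2 * √(m : ℝ)) * inner ℝ Λ (matMul (W - 1) Y) : ℝ) : EReal)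

/-- `P(x, Λ) = max_Y Φ(𝟏xᵀ, Λ, Y)`. -/
def bigP {m n₁ n₂ : ℕ} (f : Fin m → PairVec n₁ n₂ → ℝ) (h : Vec n₂ → EReal)
    (W : Matrix (Fin m) (Fin m) ℝ) (L : ℝ) (x : Vec n₁) (Λ : Stack m n₂) : EReal :=
  ⨆ Y : Stack m n₂, bigPhi f h W L (rep m x) Λ Y

/-- `φ(x, Λ) = P(x, Λ) + g(x)`. -/
def phi {m n₁ n₂ : ℕ} (f : Fin m → PairVec n₁ n₂ → ℝ) (g : Vec n₁ → EReal) (h : Vec n₂ → EReal)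
    (W : Matrix (Fin m) (Fin m) ℝ) (L : ℝ) (x : Vec n₁) (Λ : Stack m n₂) : EReal :=
  bigP f h W L x Λ + g x

/-! ### The algorithm -/

/-- The local objective `dᵢ(y) = fᵢ(xᵢ, y) - h(y) - (L√m/2) ⟨λ̃ᵢ, y⟩` of agent `i`, where
`λ̃ᵢ = ∑ⱼ wⱼᵢ λⱼ - λᵢ`. -/
def localObj {m n₁ n₂ : ℕ} (f : Fin m → PairVec n₁ n₂ → ℝ) (h : Vec n₂ → EReal)
    (W : Matrix (Fin m) (Fin m) ℝ) (L : ℝ) (X : Stack m n₁) (Λ : Stack m n₂) (i : Fin m)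
    (y : Vec n₂) : EReal :=
  (f i (pair (X i) y) : EReal) - h y
    - ((L * √(m : ℝ) / 2 * inner ℝ ((∑ j, W j i • Λ j) - Λ i) y : ℝ) : EReal)

/-- `(Xᵗ, Λᵗ, Yᵗ, Vᵗ)` is a sequence generated by D-GDMax from the starting point `x0`, with
stepsizes `ηx`, `ηl` and tolerances `δ`. The distance to an empty subdifferential is `+∞`. -/
structure IsRun {m n₁ n₂ : ℕ} (f : Fin m → PairVec n₁ n₂ → ℝ) (g : Vec n₁ → EReal)
    (h : Vec n₂ → EReal) (W : Matrix (Fin m) (Fin m) ℝ) (L : ℝ) (x0 : Vec n₁) (ηx ηl : ℝ)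
    (δ : ℕ → ℝ) (X : ℕ → Stack m n₁) (Λ Y : ℕ → Stack m n₂) (V : ℕ → Stack m n₁) : Prop where
  x_init : ∀ i, X 0 i = x0
  l_init : ∀ i, Λ 0 i = 0
  v_init : ∀ i, V 0 i = gradX (f i) (X 0 i) (Y 0 i)
  x_step : ∀ t i, X (t + 1) i = prox (scale ηx g) ((∑ j, W i j • X t j) - ηx • V t i)
  l_step : ∀ t i, Λ (t + 1) i =
    Λ t i + (L * ηl / (2 * √(m : ℝ))) • ((∑ j, W i j • Y t j) - Y t i)
  y_step : ∀ t i, Metric.infEDist (0 : Vec n₂)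
    (superdifferential (localObj f h W L (X t) (Λ t) i) (Y t i)) ≤ ENNReal.ofReal (δ t)
  v_step : ∀ t i, V (t + 1) i =
    (∑ j, W i j • V t j) + gradX (f i) (X (t + 1) i) (Y (t + 1) i) - gradX (f i) (X t i) (Y t i)

/-! ### Stationarity -/

/-- The expectation of `Z_τ` for `τ` uniformly distributed on `{0, …, T - 1}`. -/
def uniformExp (T : ℕ) (Z : ℕ → ℝ) : ℝ := (1 / (T : ℝ)) * ∑ t ∈ Finset.range T, Z t

/-- `v` is a gradient `∇ₓ P(x, Λ)`. As the functions `fᵢ` are only given near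
`dom g × dom h`, it is the gradient of `P(·, Λ)` as a function on `dom g`. -/
def IsGradXP {m n₁ n₂ : ℕ} (f : Fin m → PairVec n₁ n₂ → ℝ) (g : Vec n₁ → EReal)
    (h : Vec n₂ → EReal) (W : Matrix (Fin m) (Fin m) ℝ) (L : ℝ) (x : Vec n₁) (Λ : Stack m n₂)
    (v : Vec n₁) : Prop :=
  HasGradientWithinAt (fun x' => (bigP f h W L x' Λ).toReal) v (dom g) x

/-- `w` is the gradient `∇_Λ P(x, Λ)`. -/
def IsGradLP {m n₁ n₂ : ℕ} (f : Fin m → PairVec n₁ n₂ → ℝ)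
    (h : Vec n₂ → EReal) (W : Matrix (Fin m) (Fin m) ℝ) (L : ℝ) (x : Vec n₁) (Λ : Stack m n₂)
    (w : Stack m n₂) : Prop :=
  HasGradientAt (fun Λ' => (bigP f h W L x Λ').toReal) w Λ

/-- For `τ` uniform on `{0, …, T - 1}`, `(X^τ, Λ^τ)` is an `ε`-stationary point in expectation,
with prox parameter `η`: the gradients of `P` exist at the iterates, and, whichever gradients
are taken (`∇ₓ P` relative to `dom g` need not be unique if `dom g` has empty interior), the
expectations of the prox-gradient residual, of the consensus error and of `‖∇_Λ P‖_F` are at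
most `ε`. -/
def IsEpsStationaryInExpectation {m n₁ n₂ : ℕ} (f : Fin m → PairVec n₁ n₂ → ℝ)
    (g : Vec n₁ → EReal) (h : Vec n₂ → EReal) (W : Matrix (Fin m) (Fin m) ℝ) (L : ℝ)
    (η ε : ℝ) (T : ℕ) (X : ℕ → Stack m n₁) (Λ : ℕ → Stack m n₂) : Prop :=
  (∀ t < T, avg (X t) ∈ dom g ∧
    (∃ v, IsGradXP f g h W L (avg (X t)) (Λ t) v) ∧
    (∃ w, IsGradLP f h W L (avg (X t)) (Λ t) w)) ∧
  (∀ v : ℕ → Vec n₁, (∀ t < T, IsGradXP f g h W L (avg (X t)) (Λ t) (v t)) →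
    uniformExp T (fun t =>
      (1 / η) * ‖avg (X t) - prox (scale η g) (avg (X t) - η • v t)‖) ≤ ε) ∧
  uniformExp T (fun t => L / √(m : ℝ) * ‖perp (X t)‖) ≤ ε ∧
  (∀ w : ℕ → Stack m n₂, (∀ t < T, IsGradLP f h W L (avg (X t)) (Λ t) (w t)) →
    uniformExp T (fun t => ‖w t‖) ≤ ε)

/-! ### The constants of the result -/

/-- `η_x = (1-ρ)² / (5 L √(1 + 6κ²))`. -/
def stepX (ρ L κ : ℝ) : ℝ := (1 - ρ) ^ 2 / (5 * L * √(1 + 6 * κ ^ 2))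

/-- `η_λ = (1-ρ)² / (L (9κ + 2))`. -/
def stepL (ρ L κ : ℝ) : ℝ := (1 - ρ) ^ 2 / (L * (9 * κ + 2))

/-- The number of iterations
`T = ⌈ ε⁻² max { 64 (10 L κ (φ₀ + 1) + 1)/(1-ρ)², 4096 L κ/(1-ρ), 800 } ⌉`. -/
def numIter (ρ L κ φ₀ ε : ℝ) : ℕ :=
  ⌈(1 / ε ^ 2) * max (64 * (10 * L * κ * (φ₀ + 1) + 1) / (1 - ρ) ^ 2)
    (max (4096 * L * κ / (1 - ρ)) 800)⌉₊

end DGDMax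

end

noncomputable section

namespace DGDMax

open Filter Topology

/-! ### Closed convex functions -/

section ClosedConvex

variable {n : ℕ} {r : Vec n → EReal}

/-! The Lyapunov function is `φ(x_avg, Λ) = P + g`. Up to controllable errors, D-GDMax is a proximal
gradient step in `x_avg` and a gradient step in `Λ` on it.

Moving `W - I` onto `Λ` makes the inner maximization separate into one `μ`-strongly concave problem
per agent. Its maximizers depend on `(X, √m Λ)` with Lipschitz constant `κ`
(`IsProblem.norm_argY_sub_le`). Near any point, `P` lies between two quadratics with the same linear
part (`IsProblem.valP_lower`, `IsProblem.valP_upper`). This gives both the gradients of `P` and a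
descent inequality, although the `fᵢ` are only given near `dom g × dom h`.

The errors in the steps have three sources: the consensus error `X_⊥`, the error `V_⊥` of the
tracked gradients, and the inexact maximization. Mixing contracts the first two by `ρ`
(`IsMixing.norm_perp_matMul_le`) and proximal maps do not enlarge the distance to a consensus. Hence
`X_⊥` is driven by `η_x V_⊥`, and `V_⊥` by the change of the local gradients, which is again bounded
by the primal and dual steps, `X_⊥` and the tolerances. The tolerances are square summable.

All these relations are recorded for real sequences in `IsScalarRun`. There the stepsizes are small
enough for the loop of estimates to close: the summed consensus errors are small multiples of the
summed squared steps, and the summed descent then bounds those steps (`IsScalarRun.sum_bounds`).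
Each stationarity measure at time `t` is bounded by the scaled steps and errors at time `t`, so its
squares have a sum bounded independently of `T` (`IsScalarRun.stationarity_bounds`), and
Cauchy–Schwarz (`uniformExp_le`) gives the mean.

A gradient relative to `dom g` is determined only through its pairing with `z - x`, `z ∈ dom g`; the
proximal residual sees nothing else (`prox_scale_congr`). -/

theorem IsClosedConvex.coe_toReal (hr : IsClosedConvex r) {x : Vec n} (hx : x ∈ dom r) :
    ((r x).toReal : EReal) = r x :=
  EReal.coe_toReal (ne_of_lt hx) (hr.1 x)

theorem IsClosedConvex.combo (hr : IsClosedConvex r) {x y : Vec n} (hx : x ∈ dom r)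
    (hy : y ∈ dom r) {a b : ℝ} (ha : 0 ≤ a) (hb : 0 ≤ b) (hab : a + b = 1) :
    a • x + b • y ∈ dom r ∧
      (r (a • x + b • y)).toReal ≤ a * (r x).toReal + b * (r y).toReal := by
  have key := hr.2.1 (x := (x, (r x).toReal)) (by simp [hr.coe_toReal hx])
    (y := (y, (r y).toReal)) (by simp [hr.coe_toReal hy]) ha hb hab
  simp only [Prod.smul_mk, Prod.mk_add_mk, Set.mem_ofPred_eq, smul_eq_mul] at key
  have hd : a • x + b • y ∈ dom r := lt_of_le_of_lt key (EReal.coe_lt_top _)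
  refine ⟨hd, ?_⟩
  rw [← hr.coe_toReal hd] at key
  exact_mod_cast key

theorem IsClosedConvex.convex_dom (hr : IsClosedConvex r) : Convex ℝ (dom r) :=
  fun _ hx _ hy _ _ ha hb hab => (hr.combo hx hy ha hb hab).1

theorem IsClosedConvex.segment (hr : IsClosedConvex r) {x y : Vec n} (hx : x ∈ dom r)
    (hy : y ∈ dom r) {s : ℝ} (h0 : 0 ≤ s) (h1 : s ≤ 1) :
    x + s • (y - x) ∈ dom r ∧
      (r (x + s • (y - x))).toReal ≤ (1 - s) * (r x).toReal + s * (r y).toReal := by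
  have h := hr.combo hx hy (sub_nonneg.2 h1) h0 (by ring)
  have e : (1 - s) • x + s • y = x + s • (y - x) := by module
  rwa [e] at h

theorem IsClosedConvex.jensen (hr : IsClosedConvex r) {m : ℕ} (hm : 0 < m) (x : Fin m → Vec n)
    (hx : ∀ i, x i ∈ dom r) :
    (1 / (m : ℝ)) • ∑ i, x i ∈ dom r ∧
      (r ((1 / (m : ℝ)) • ∑ i, x i)).toReal ≤ (1 / (m : ℝ)) * ∑ i, (r (x i)).toReal := by
  have hm' : (m : ℝ) ≠ 0 := by positivity
  have key := hr.2.1.sum_mem (t := Finset.univ) (w := fun _ : Fin m => 1 / (m : ℝ))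
    (z := fun i => (x i, (r (x i)).toReal)) (fun _ _ => by positivity)
    (by simp [hm']) (fun i _ => by simp [hr.coe_toReal (hx i)])
  simp only [Set.mem_ofPred_eq, Prod.fst_sum, Prod.snd_sum, Prod.smul_fst, Prod.smul_snd,
    smul_eq_mul, ← Finset.smul_sum] at key
  have hd : (1 / (m : ℝ)) • ∑ i, x i ∈ dom r := lt_of_le_of_lt key (EReal.coe_lt_top _)
  refine ⟨hd, ?_⟩
  rw [← hr.coe_toReal hd] at key
  exact_mod_cast key

theorem IsClosedConvex.eventually_lt (hr : IsClosedConvex r) {x : Vec n} (hx : x ∈ dom r) {t : ℝ}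
    (ht : t < (r x).toReal) : ∀ᶠ y in 𝓝 x, (t : EReal) < r y := by
  refine hr.2.2 x t ?_
  change (t : EReal) < r x
  rw [← hr.coe_toReal hx]
  exact_mod_cast ht

/-- A minimizer of `r + φ` with `φ` strongly convex on `dom r` satisfies quadratic growth. -/
theorem IsClosedConvex.growth (hr : IsClosedConvex r) {φ : Vec n → ℝ} {G : Vec n → Vec n} {μ : ℝ}
    (hs : ∀ y ∈ dom r, ∀ y' ∈ dom r,
      φ y + inner ℝ (G y) (y' - y) + μ / 2 * ‖y' - y‖ ^ 2 ≤ φ y')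
    {z : Vec n} (hz : z ∈ dom r)
    (hmin : ∀ y ∈ dom r, (r z).toReal + φ z ≤ (r y).toReal + φ y) {y : Vec n} (hy : y ∈ dom r) :
    (r z).toReal + φ z + μ / 2 * ‖y - z‖ ^ 2 ≤ (r y).toReal + φ y := by
  have key : ∀ s : ℝ, s ∈ Set.Ioo (0 : ℝ) 1 →
      (r z).toReal + φ z + μ / 2 * (1 - s) * ‖y - z‖ ^ 2 ≤ (r y).toReal + φ y := by
    intro s hs'
    obtain ⟨h0, h1⟩ := hs'
    obtain ⟨hw, hrw⟩ := hr.segment hz hy h0.le h1.le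
    set w := z + s • (y - z) with hwdef
    have e1 := hs w hw z hz
    have e2 := hs w hw y hy
    have e3 := hmin w hw
    have d1 : z - w = (-s) • (y - z) := by rw [hwdef]; module
    have d2 : y - w = (1 - s) • (y - z) := by rw [hwdef]; module
    rw [d1, inner_smul_right, norm_smul, mul_pow, Real.norm_eq_abs, sq_abs] at e1
    rw [d2, inner_smul_right, norm_smul, mul_pow, Real.norm_eq_abs, sq_abs] at e2
    -- With weights `1 - s` and `s` the gradient terms at `w` cancel and the quadratic terms add up
    -- to `μ/2 · s(1 - s)‖y - z‖²`. Dividing by `s` and letting `s → 0` gives the full modulus.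
    have e4 : s * ((r z).toReal + φ z + μ / 2 * (1 - s) * ‖y - z‖ ^ 2)
        ≤ s * ((r y).toReal + φ y) := by
      have f1 := mul_le_mul_of_nonneg_left e1 (sub_nonneg.2 h1.le)
      have f2 := mul_le_mul_of_nonneg_left e2 h0.le
      linarith
    exact le_of_mul_le_mul_left e4 h0
  have hlim : Tendsto (fun s : ℝ => (r z).toReal + φ z + μ / 2 * (1 - s) * ‖y - z‖ ^ 2) (𝓝[>] 0)
      (𝓝 ((r z).toReal + φ z + μ / 2 * (1 - 0) * ‖y - z‖ ^ 2)) := by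
    apply Tendsto.mono_left _ nhdsWithin_le_nhds
    apply Continuous.tendsto
    fun_prop
  have := le_of_tendsto hlim (by
    filter_upwards [Ioo_mem_nhdsGT (zero_lt_one' ℝ)] with s hs' using key s hs')
  simpa using this

/-- The sum of a closed convex function and a strongly convex function attains its minimum. -/
theorem IsClosedConvex.exists_min (hr : IsClosedConvex r) (hne : (dom r).Nonempty)
    {φ : Vec n → ℝ} {G : Vec n → Vec n} {μ : ℝ} (hμ : 0 < μ) (hc : ContinuousOn φ (dom r))
    (hs : ∀ y ∈ dom r, ∀ y' ∈ dom r,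
      φ y + inner ℝ (G y) (y' - y) + μ / 2 * ‖y' - y‖ ^ 2 ≤ φ y') :
    ∃ z ∈ dom r, ∀ y ∈ dom r,
      (r z).toReal + φ z + μ / 2 * ‖y - z‖ ^ 2 ≤ (r y).toReal + φ y := by
  obtain ⟨y₀, hy₀⟩ := hne
  -- Lower semicontinuity bounds `r` below on a ball about `y₀`. A farther point `y` is compared
  -- with the point at distance `ε/2` on the segment from `y₀`, and convexity limits the decrease to
  -- slope `2/ε`. Strong convexity of `φ` beats this linear decrease.
  have hlow : ∃ c : ℝ, 0 ≤ c ∧ ∀ y ∈ dom r, (r y₀).toReal - 1 - c * ‖y - y₀‖ ≤ (r y).toReal := by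
    have hl := hr.eventually_lt hy₀ (sub_one_lt _)
    obtain ⟨ε, hε, hball⟩ := Metric.eventually_nhds_iff.1 hl
    refine ⟨2 / ε, by positivity, fun y hy => ?_⟩
    rcases lt_or_ge ‖y - y₀‖ ε with hlt | hge
    · have h1 := hball (y := y) (by rwa [dist_eq_norm])
      rw [← hr.coe_toReal hy] at h1
      have h2 : (r y₀).toReal - 1 < (r y).toReal := by exact_mod_cast h1
      have h3 : 0 ≤ 2 / ε * ‖y - y₀‖ := by positivity
      linarith
    · have hN : 0 < ‖y - y₀‖ := lt_of_lt_of_le hε hge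
      set s := ε / 2 / ‖y - y₀‖ with hsdef
      have hs0 : 0 < s := by positivity
      have hs1 : s ≤ 1 := by rw [hsdef, div_le_one hN]; linarith
      obtain ⟨hw, hrw⟩ := hr.segment hy₀ hy hs0.le hs1
      have h1 := hball (y := y₀ + s • (y - y₀)) (by
        rw [dist_eq_norm, add_sub_cancel_left, norm_smul, Real.norm_eq_abs, abs_of_pos hs0, hsdef,
          div_mul_cancel₀ _ hN.ne']
        linarith)
      rw [← hr.coe_toReal hw] at h1
      have h2 : (r y₀).toReal - 1 < (r (y₀ + s • (y - y₀))).toReal := by exact_mod_cast h1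
      have h3 : s * ((r y₀).toReal - (r y).toReal) ≤ 1 := by linarith
      have h4 : s * (2 / ε * ‖y - y₀‖) = 1 := by rw [hsdef]; field_simp
      have h5 : s * ((r y₀).toReal - (r y).toReal) ≤ s * (2 / ε * ‖y - y₀‖) := by rw [h4]; exact h3
      have := le_of_mul_le_mul_left h5 hs0
      linarith
  obtain ⟨c, hc0, hlow⟩ := hlow
  set F₀ := (r y₀).toReal + φ y₀ with hF₀
  set M := max 1 (2 * (1 + c + ‖G y₀‖) / μ) with hM
  have hφ : ∀ y ∈ dom r, φ y₀ - ‖G y₀‖ * ‖y - y₀‖ + μ / 2 * ‖y - y₀‖ ^ 2 ≤ φ y := by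
    intro y hy
    have h1 := hs y₀ hy₀ y hy
    have h2 := neg_le_of_abs_le (abs_real_inner_le_norm (G y₀) (y - y₀))
    linarith
  have hbd : ∀ y ∈ dom r, (r y).toReal + φ y ≤ F₀ → ‖y - y₀‖ ≤ M := by
    intro y hy hle
    by_contra! hcon
    have h1 : 1 < ‖y - y₀‖ := lt_of_le_of_lt (le_max_left _ _) hcon
    have h2 : 2 * (1 + c + ‖G y₀‖) / μ < ‖y - y₀‖ := lt_of_le_of_lt (le_max_right _ _) hcon
    rw [div_lt_iff₀ hμ] at h2
    have h3 := hφ y hy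
    have h4 := hlow y hy
    nlinarith [norm_nonneg (G y₀)]
  set C := F₀ - φ y₀ + ‖G y₀‖ * M with hC
  have hrC : ∀ y ∈ dom r, (r y).toReal + φ y ≤ F₀ → (r y).toReal ≤ C := by
    intro y hy hle
    have h1 := hbd y hy hle
    have h2 := hφ y hy
    have h3 : ‖G y₀‖ * ‖y - y₀‖ ≤ ‖G y₀‖ * M := by gcongr
    have h4 : 0 ≤ μ / 2 * ‖y - y₀‖ ^ 2 := by positivity
    linarith
  -- Since `φ` is continuous only on `dom r`, sublevel sets of `r + φ` need not be closed. A
  -- sublevel set of `r` is closed and stays inside `dom r`.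
  set K := Metric.closedBall y₀ M ∩ r ⁻¹' Set.Iic (C : EReal) with hK
  have hKc : IsCompact K :=
    (isCompact_closedBall y₀ M).inter_right (hr.2.2.isClosed_preimage _)
  have hKd : K ⊆ dom r := fun y hy => lt_of_le_of_lt hy.2 (EReal.coe_lt_top _)
  have hmemK : ∀ y ∈ dom r, (r y).toReal + φ y ≤ F₀ → y ∈ K := by
    intro y hy hle
    refine ⟨by rw [Metric.mem_closedBall, dist_eq_norm]; exact hbd y hy hle, ?_⟩
    simp only [Set.mem_preimage, Set.mem_Iic]
    rw [← hr.coe_toReal hy]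
    exact_mod_cast hrC y hy hle
  have hlsc : LowerSemicontinuousOn (fun y => (r y).toReal + φ y) K := by
    refine LowerSemicontinuousOn.add ?_ (hc.mono hKd).lowerSemicontinuousOn
    intro x hx t ht
    filter_upwards [(hr.eventually_lt (hKd hx) ht).filter_mono nhdsWithin_le_nhds,
      self_mem_nhdsWithin] with y h2 hy
    rw [← hr.coe_toReal (hKd hy)] at h2
    exact_mod_cast h2
  obtain ⟨z, hzK, hz⟩ := hlsc.exists_isMinOn ⟨y₀, hmemK y₀ hy₀ le_rfl⟩ hKc
  refine ⟨z, hKd hzK, fun y hy => hr.growth hs (hKd hzK) (fun y hy => ?_) hy⟩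
  rcases le_or_gt ((r y).toReal + φ y) F₀ with hle | hgt
  · exact hz (hmemK y hy hle)
  · exact le_trans (hz (hmemK y₀ hy₀ le_rfl)) hgt.le

/-! ### The proximal mapping -/

theorem inner_sub_le_of_three_point {E : Type*} [NormedAddCommGroup E] [InnerProductSpace ℝ E]
    {u p z : E} {c : ℝ} (h : ‖p - u‖ ^ 2 / 2 + ‖z - p‖ ^ 2 / 2 ≤ c + ‖z - u‖ ^ 2 / 2) :
    inner ℝ (u - p) (z - p) ≤ c := by
  have e : z - u = (z - p) + (p - u) := by abel
  rw [e, norm_add_sq_real] at h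
  have e2 : inner ℝ (z - p) (p - u) = - inner ℝ (u - p) (z - p) := by
    rw [← neg_sub u p, inner_neg_right, real_inner_comm]
  rw [e2] at h
  linarith

theorem isMinOn_scale_iff (hr : IsClosedConvex r) (hne : (dom r).Nonempty) {η : ℝ} (hη : 0 < η)
    (u z : Vec n) :
    IsMinOn (fun w => scale η r w + ((‖w - u‖ ^ 2 / 2 : ℝ) : EReal)) Set.univ z ↔
      z ∈ dom r ∧ ∀ y ∈ dom r,
        η * (r z).toReal + ‖z - u‖ ^ 2 / 2 ≤ η * (r y).toReal + ‖y - u‖ ^ 2 / 2 := by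
  have hval : ∀ w ∈ dom r, scale η r w + ((‖w - u‖ ^ 2 / 2 : ℝ) : EReal)
      = ((η * (r w).toReal + ‖w - u‖ ^ 2 / 2 : ℝ) : EReal) := by
    intro w hw
    rw [scale, ← hr.coe_toReal hw]
    simp only [EReal.toReal_coe]
    push_cast
    rfl
  have htop : ∀ w, w ∉ dom r → scale η r w + ((‖w - u‖ ^ 2 / 2 : ℝ) : EReal) = ⊤ := by
    intro w hw
    have : r w = ⊤ := by simpa [dom] using hw
    rw [scale, this, EReal.coe_mul_top_of_pos hη]
    exact EReal.top_add_coe _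
  constructor
  · intro hmin
    obtain ⟨y₀, hy₀⟩ := hne
    have hz : z ∈ dom r := by
      by_contra hcon
      have h1 := hmin (Set.mem_univ y₀)
      simp only [Set.mem_ofPred_eq] at h1
      rw [htop z hcon, hval y₀ hy₀] at h1
      exact absurd h1 (not_le.2 (EReal.coe_lt_top _))
    refine ⟨hz, fun y hy => ?_⟩
    have h1 := hmin (Set.mem_univ y)
    simp only [Set.mem_ofPred_eq] at h1
    rw [hval z hz, hval y hy] at h1
    exact_mod_cast h1
  · rintro ⟨hz, hmin⟩ y -
    simp only [Set.mem_ofPred_eq]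
    by_cases hy : y ∈ dom r
    · rw [hval z hz, hval y hy]
      exact_mod_cast hmin y hy
    · rw [htop y hy]
      exact le_top

/-- Divided by `η`, the proximal objective is `r` plus a `1/η`-strongly convex function, so a
minimizer exists and the choice made in `prox` is a true one. Quadratic growth at the minimizer,
rewritten with the three-point identity, is the variational inequality through which `prox` is used
from here on. -/
theorem prox_scale_spec (hr : IsClosedConvex r) (hne : (dom r).Nonempty) {η : ℝ} (hη : 0 < η)
    (u : Vec n) :
    prox (scale η r) u ∈ dom r ∧ ∀ z ∈ dom r,
      inner ℝ (u - prox (scale η r) u) (z - prox (scale η r) u)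
        ≤ η * ((r z).toReal - (r (prox (scale η r) u)).toReal) := by
  have hs : ∀ y ∈ dom r, ∀ y' ∈ dom r, ‖y - u‖ ^ 2 / (2 * η)
      + inner ℝ ((1 / η) • (y - u)) (y' - y) + (1 / η) / 2 * ‖y' - y‖ ^ 2
        ≤ ‖y' - u‖ ^ 2 / (2 * η) := by
    intro y _ y' _
    have e : y' - u = (y - u) + (y' - y) := by abel
    rw [e, norm_add_sq_real, real_inner_smul_left]
    apply le_of_eq
    field_simp
  obtain ⟨z, hz, hzmin⟩ := hr.exists_min hne (μ := 1 / η) (by positivity)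
    (φ := fun y => ‖y - u‖ ^ 2 / (2 * η)) (by fun_prop) hs
  have hmul : ∀ y, η * ((r y).toReal + ‖y - u‖ ^ 2 / (2 * η))
      = η * (r y).toReal + ‖y - u‖ ^ 2 / 2 := by
    intro y; field_simp
  have hex : ∃ z, IsMinOn (fun w => scale η r w + ((‖w - u‖ ^ 2 / 2 : ℝ) : EReal)) Set.univ z := by
    refine ⟨z, (isMinOn_scale_iff hr hne hη u z).2 ⟨hz, fun y hy => ?_⟩⟩
    rw [← hmul, ← hmul]
    have h1 := hzmin y hy
    have h2 : 0 ≤ 1 / η / 2 * ‖y - z‖ ^ 2 := by positivity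
    gcongr ?_ * ?_
    linarith
  have hp := Classical.epsilon_spec hex
  obtain ⟨hpd, hpm⟩ := (isMinOn_scale_iff hr hne hη u _).1 hp
  refine ⟨hpd, fun y hy => ?_⟩
  have h1 := hr.growth (φ := fun y => ‖y - u‖ ^ 2 / (2 * η)) hs hpd (fun y hy => by
    have := hpm y hy
    rw [← hmul, ← hmul] at this
    exact le_of_mul_le_mul_left this hη) hy
  apply inner_sub_le_of_three_point
  have h2 := mul_le_mul_of_nonneg_left h1 hη.le
  rw [mul_add, hmul, hmul] at h2
  have h3 : η * (1 / η / 2 * ‖y - prox (scale η r) u‖ ^ 2)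
    = ‖y - prox (scale η r) u‖ ^ 2 / 2 := by field_simp
  unfold prox at h3 ⊢
  rw [h3] at h2
  linarith

/-- Firm nonexpansiveness: each variational inequality is tested at the other proximal point and the
two are added. -/
theorem norm_sq_prox_sub_le (hr : IsClosedConvex r) (hne : (dom r).Nonempty) {η : ℝ}
    (hη : 0 < η) (u v : Vec n) :
    ‖prox (scale η r) u - prox (scale η r) v‖ ^ 2
      ≤ inner ℝ (u - v) (prox (scale η r) u - prox (scale η r) v) := by
  obtain ⟨hu, hu'⟩ := prox_scale_spec hr hne hη u
  obtain ⟨hv, hv'⟩ := prox_scale_spec hr hne hη v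
  have h1 := hu' _ hv
  have h2 := hv' _ hu
  set p := prox (scale η r) u
  set q := prox (scale η r) v
  rw [← real_inner_self_eq_norm_sq]
  have e1 : inner ℝ (u - p) (q - p) = - inner ℝ (u - p) (p - q) := by
    rw [← neg_sub p q, inner_neg_right]
  have e2 : inner ℝ (u - v) (p - q) - inner ℝ (p - q) (p - q)
    = inner ℝ (u - p) (p - q) - inner ℝ (v - q) (p - q) := by
    rw [← inner_sub_left, ← inner_sub_left]; congr 1; abel
  linarith

theorem prox_scale_nonexpansive (hr : IsClosedConvex r) (hne : (dom r).Nonempty) {η : ℝ}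
    (hη : 0 < η) (u v : Vec n) :
    ‖prox (scale η r) u - prox (scale η r) v‖ ≤ ‖u - v‖ := by
  have h3 := norm_sq_prox_sub_le hr hne hη u v
  set p := prox (scale η r) u
  set q := prox (scale η r) v
  have h4 := real_inner_le_norm (u - v) (p - q)
  rcases eq_or_lt_of_le (norm_nonneg (p - q)) with h0 | h0
  · rw [← h0]; positivity
  · nlinarith

/-- The proximal point only depends on the argument up to directions orthogonal to `dom r`. -/
theorem prox_scale_congr (hr : IsClosedConvex r) (hne : (dom r).Nonempty) {η : ℝ} (hη : 0 < η)
    {u v x : Vec n} (huv : ∀ z ∈ dom r, inner ℝ (u - v) (z - x) = 0) :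
    prox (scale η r) u = prox (scale η r) v := by
  have h3 := norm_sq_prox_sub_le hr hne hη u v
  have h5 := huv _ (prox_scale_spec hr hne hη u).1
  have h6 := huv _ (prox_scale_spec hr hne hη v).1
  set p := prox (scale η r) u
  set q := prox (scale η r) v
  have e : p - q = (p - x) - (q - x) := by abel
  rw [e, inner_sub_right, h5, h6, ← e] at h3
  have h4 : ‖p - q‖ = 0 := by
    have := norm_nonneg (p - q)
    nlinarith
  exact sub_eq_zero.1 (norm_eq_zero.1 h4)

end ClosedConvex

/-! ### Stacks of vectors -/

section Stack

variable {m n : ℕ}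

theorem norm_sq_stack (X : Stack m n) : ‖X‖ ^ 2 = ∑ i, ‖X i‖ ^ 2 :=
  PiLp.norm_sq_eq_of_L2 _ X

theorem inner_stack (X Z : Stack m n) : (inner ℝ X Z : ℝ) = ∑ i, inner ℝ (X i) (Z i) :=
  PiLp.inner_apply X Z

theorem norm_stack_le {X : Stack m n} {c : ℝ} (hc : 0 ≤ c) (h : ∑ i, ‖X i‖ ^ 2 ≤ c ^ 2) :
    ‖X‖ ≤ c := by
  rw [← norm_sq_stack] at h
  exact (sq_le_sq₀ (norm_nonneg _) hc).1 h

@[simp] theorem rep_apply (x : Vec n) (i : Fin m) : rep m x i = x := rfl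

@[simp] theorem perp_apply (X : Stack m n) (i : Fin m) : perp X i = X i - avg X := rfl

@[simp] theorem matMul_apply (A : Matrix (Fin m) (Fin m) ℝ) (X : Stack m n) (i : Fin m) :
    matMul A X i = ∑ j, A i j • X j := rfl

theorem norm_sq_rep (x : Vec n) : ‖rep m x‖ ^ 2 = m * ‖x‖ ^ 2 := by
  simp [norm_sq_stack]

/-- `A` acts on every column of `X` separately, and the squared Frobenius norm is the sum over
columns. -/
theorem norm_sq_matMul_le (A : Matrix (Fin m) (Fin m) ℝ) (X : Stack m n) :
    ‖matMul A X‖ ^ 2 ≤ specNorm A ^ 2 * ‖X‖ ^ 2 := by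
  have hcol : ∀ Z : Stack m n, ‖Z‖ ^ 2
      = ∑ k, ‖(WithLp.toLp 2 (fun i => Z i k) : EuclideanSpace ℝ (Fin m))‖ ^ 2 := by
    intro Z
    simp_rw [norm_sq_stack, EuclideanSpace.norm_sq_eq]
    exact Finset.sum_comm
  rw [hcol, hcol X, Finset.mul_sum]
  refine Finset.sum_le_sum fun k _ => ?_
  have h1 := (Matrix.toEuclideanCLM (n := Fin m) (𝕜 := ℝ) A).le_opNorm
    (WithLp.toLp 2 (fun i => X i k))
  have e : Matrix.toEuclideanCLM (n := Fin m) (𝕜 := ℝ) A (WithLp.toLp 2 (fun i => X i k))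
      = WithLp.toLp 2 (fun i => matMul A X i k) := by
    ext i
    simp [Matrix.mulVec, dotProduct]
  rw [e] at h1
  rw [← mul_pow]
  exact pow_le_pow_left₀ (norm_nonneg _) h1 2

theorem specNorm_nonneg (A : Matrix (Fin m) (Fin m) ℝ) : 0 ≤ specNorm A := norm_nonneg _

theorem norm_matMul_le (A : Matrix (Fin m) (Fin m) ℝ) (X : Stack m n) :
    ‖matMul A X‖ ≤ specNorm A * ‖X‖ := by
  have h := norm_sq_matMul_le A X
  rw [← mul_pow] at h
  exact (sq_le_sq₀ (norm_nonneg _) (mul_nonneg (specNorm_nonneg A) (norm_nonneg _))).1 h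

theorem avg_sub (X Z : Stack m n) : avg (X - Z) = avg X - avg Z := by
  simp [avg, smul_sub]

theorem avg_add (X Z : Stack m n) : avg (X + Z) = avg X + avg Z := by
  simp [avg, Finset.sum_add_distrib]

theorem avg_smul (c : ℝ) (X : Stack m n) : avg (c • X) = c • avg X := by
  simp [avg, ← Finset.smul_sum, smul_comm c]

theorem perp_sub (X Z : Stack m n) : perp (X - Z) = perp X - perp Z := by
  ext1 i; simp only [perp_apply, PiLp.sub_apply, avg_sub]; abel

theorem perp_add (X Z : Stack m n) : perp (X + Z) = perp X + perp Z := by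
  ext1 i; simp only [perp_apply, PiLp.add_apply, avg_add]; abel

theorem perp_smul (c : ℝ) (X : Stack m n) : perp (c • X) = c • perp X := by
  ext1 i; simp only [perp_apply, PiLp.smul_apply, avg_smul, smul_sub]

theorem sum_eq_smul_avg (hm : 0 < m) (X : Stack m n) : ∑ i, X i = (m : ℝ) • avg X := by
  have : (m : ℝ) ≠ 0 := by positivity
  simp [avg, smul_smul, this]

theorem avg_rep (hm : 0 < m) (x : Vec n) : avg (rep m x) = x := by
  have h := sum_eq_smul_avg hm (rep m x)
  have hm' : (m : ℝ) ≠ 0 := by positivity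
  simp only [rep_apply, Finset.sum_const, Finset.card_univ, Fintype.card_fin,
    ← Nat.cast_smul_eq_nsmul ℝ] at h
  exact (smul_right_injective _ hm' h).symm

theorem sum_perp (hm : 0 < m) (X : Stack m n) : ∑ i, perp X i = 0 := by
  simp [Finset.sum_sub_distrib, sum_eq_smul_avg hm, ← Nat.cast_smul_eq_nsmul ℝ]

theorem inner_perp_rep (hm : 0 < m) (X : Stack m n) (x : Vec n) :
    (inner ℝ (perp X) (rep m x) : ℝ) = 0 := by
  rw [inner_stack]
  simp only [rep_apply]
  rw [← sum_inner, sum_perp hm, inner_zero_left]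

theorem perp_add_rep_avg (X : Stack m n) : perp X + rep m (avg X) = X := by
  simp [perp]

theorem inner_rep (x y : Vec n) : (inner ℝ (rep m x) (rep m y) : ℝ) = m * inner ℝ x y := by
  simp [inner_stack]

theorem inner_stack_decomp (hm : 0 < m) (X Z : Stack m n) :
    (inner ℝ X Z : ℝ) = m * inner ℝ (avg X) (avg Z) + inner ℝ (perp X) (perp Z) := by
  conv_lhs => rw [← perp_add_rep_avg X, ← perp_add_rep_avg Z]
  rw [inner_add_left, inner_add_right, inner_add_right, inner_perp_rep hm,
    real_inner_comm (perp Z) (rep m (avg X)), inner_perp_rep hm, inner_rep]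
  ring

theorem norm_sq_stack_decomp (hm : 0 < m) (X : Stack m n) :
    ‖X‖ ^ 2 = m * ‖avg X‖ ^ 2 + ‖perp X‖ ^ 2 := by
  have := inner_stack_decomp hm X X
  simpa only [real_inner_self_eq_norm_sq] using this

theorem norm_perp_le (hm : 0 < m) (X : Stack m n) : ‖perp X‖ ≤ ‖X‖ := by
  have h := norm_sq_stack_decomp hm X
  have : 0 ≤ (m : ℝ) * ‖avg X‖ ^ 2 := by positivity
  exact (sq_le_sq₀ (norm_nonneg _) (norm_nonneg _)).1 (by linarith)

theorem sqrt_mul_norm_avg_le (hm : 0 < m) (X : Stack m n) : √m * ‖avg X‖ ≤ ‖X‖ := by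
  have h := norm_sq_stack_decomp hm X
  refine (sq_le_sq₀ (by positivity) (norm_nonneg _)).1 ?_
  rw [mul_pow, Real.sq_sqrt (by positivity)]
  have := sq_nonneg ‖perp X‖
  linarith

theorem perp_rep (hm : 0 < m) (x : Vec n) : perp (rep m x) = 0 := by
  ext1 i; simp [avg_rep hm]

theorem norm_perp_le_norm_sub_rep (hm : 0 < m) (X : Stack m n) (c : Vec n) :
    ‖perp X‖ ≤ ‖X - rep m c‖ := by
  have h := norm_perp_le hm (X - rep m c)
  rwa [perp_sub, perp_rep hm, sub_zero] at h

end Stack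

/-! ### The mixing matrix: average preservation and contraction of the consensus error. -/

section Mixing

variable {m n : ℕ} {G : SimpleGraph (Fin m)} {W : Matrix (Fin m) (Fin m) ℝ}

theorem IsMixing.row_sum (hW : IsMixing G W) (i : Fin m) : ∑ j, W i j = 1 := by
  have h : (fun _ => (1 : ℝ)) ∈ LinearMap.ker (Matrix.toLin' (W - 1)) := by
    rw [hW.ker_sub_one]
    exact Submodule.mem_span_singleton_self _
  rw [LinearMap.mem_ker, Matrix.toLin'_apply] at h
  have h1 := congrFun h i
  rw [Matrix.sub_mulVec, Matrix.one_mulVec] at h1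
  simp only [Pi.sub_apply, Pi.zero_apply, Matrix.mulVec, dotProduct, mul_one] at h1
  linarith

theorem IsMixing.col_sum (hW : IsMixing G W) (j : Fin m) : ∑ i, W i j = 1 := by
  have h1 := congrFun hW.transpose_mulVec_one j
  simpa [Matrix.mulVec, dotProduct] using h1

theorem IsMixing.avg_matMul (hW : IsMixing G W) (X : Stack m n) : avg (matMul W X) = avg X := by
  simp only [avg, matMul_apply]
  rw [Finset.sum_comm]
  simp_rw [← Finset.sum_smul, hW.col_sum, one_smul]

/-- Unit row sums let `W` fix consensus matrices and unit column sums preserve the average. As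
`𝟏𝟏ᵀ/m` annihilates `X_⊥`, it may be subtracted for free, which brings in the norm `ρ < 1`. -/
theorem IsMixing.perp_matMul (hW : IsMixing G W) (hm : 0 < m) (X : Stack m n) :
    perp (matMul W X) = matMul (W - Matrix.of fun _ _ => 1 / (m : ℝ)) (perp X) := by
  ext1 i
  have e1 : ∑ j, (1 / (m : ℝ)) • perp X j = 0 := by
    rw [← Finset.smul_sum, sum_perp hm, smul_zero]
  simp only [perp_apply, hW.avg_matMul, matMul_apply, Matrix.sub_apply, Matrix.of_apply, sub_smul,
    Finset.sum_sub_distrib] at e1 ⊢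
  rw [e1, sub_zero]
  simp only [smul_sub, Finset.sum_sub_distrib]
  rw [← Finset.sum_smul, hW.row_sum, one_smul]

theorem IsMixing.norm_perp_matMul_le (hW : IsMixing G W) (hm : 0 < m) (X : Stack m n) :
    ‖perp (matMul W X)‖ ≤ rho W * ‖perp X‖ := by
  rw [hW.perp_matMul hm]
  exact norm_matMul_le _ _

theorem matMul_sub_one_apply (X : Stack m n) (i : Fin m) :
    matMul (W - 1) X i = (∑ j, W i j • X j) - X i := by
  simp [sub_smul, Finset.sum_sub_distrib, Matrix.one_apply]

theorem matMul_sub (A : Matrix (Fin m) (Fin m) ℝ) (X Z : Stack m n) :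
    matMul A (X - Z) = matMul A X - matMul A Z := by
  ext1 i; simp [smul_sub]

theorem IsMixing.matMul_sub_one_rep (hW : IsMixing G W) (y : Vec n) :
    matMul (W - 1) (rep m y) = 0 := by
  ext1 i
  rw [matMul_sub_one_apply]
  simp only [rep_apply]
  rw [← Finset.sum_smul, hW.row_sum, one_smul, sub_self]
  rfl

theorem IsMixing.norm_matMul_sub_one_le (hW : IsMixing G W) (X : Stack m n) :
    ‖matMul (W - 1) X‖ ≤ 2 * ‖X‖ :=
  (norm_matMul_le _ _).trans (mul_le_mul_of_nonneg_right hW.norm_sub_one_le (norm_nonneg _))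

/-- The rows of `(W - I)ᵀ Λ`. -/
def dualRow (W : Matrix (Fin m) (Fin m) ℝ) (Λ : Stack m n) (i : Fin m) : Vec n :=
  (∑ j, W j i • Λ j) - Λ i

/-- The adjoint of `W - I` turns the coupling term into one inner product per agent; this is why
each agent can maximize on its own. -/
theorem sum_inner_dualRow (Λ Y : Stack m n) :
    ∑ i, (inner ℝ (dualRow W Λ i) (Y i) : ℝ) = inner ℝ Λ (matMul (W - 1) Y) := by
  rw [inner_stack]
  simp only [matMul_sub_one_apply, dualRow, inner_sub_left, inner_sub_right, sum_inner, inner_sum,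
    inner_smul_left, inner_smul_right, Finset.sum_sub_distrib]
  rw [Finset.sum_comm]
  simp

theorem dualRow_sub (Λ Λ' : Stack m n) (i : Fin m) :
    dualRow W (Λ - Λ') i = dualRow W Λ i - dualRow W Λ' i := by
  simp only [dualRow, PiLp.sub_apply, smul_sub, Finset.sum_sub_distrib]; abel

end Mixing

/-! ### Calculus along segments -/

section Calculus

variable {E : Type*} [NormedAddCommGroup E] [InnerProductSpace ℝ E] [CompleteSpace E]

/-- `ψ(s) - Cs - Ks²/2` is antitone. The smoothness bound, the strong concavity bound and the mixed
difference bound (with `K = 0`) all restrict to a segment and use this. -/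
theorem sub_le_of_deriv_le_affine {ψ ψ' : ℝ → ℝ} {C K : ℝ}
    (hd : ∀ s ∈ Set.Icc (0 : ℝ) 1, HasDerivAt ψ (ψ' s) s)
    (hb : ∀ s ∈ Set.Icc (0 : ℝ) 1, ψ' s ≤ C + K * s) : ψ 1 - ψ 0 ≤ C + K / 2 := by
  have hd' : ∀ s ∈ Set.Icc (0 : ℝ) 1,
      HasDerivAt (fun s => ψ s - C * s - K * s ^ 2 / 2) (ψ' s - C - K * s) s := by
    intro s hs
    have h2 : HasDerivAt (fun s : ℝ => C * s) C s := by
      simpa using (hasDerivAt_id s).const_mul C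
    have h3 : HasDerivAt (fun s : ℝ => K * s ^ 2 / 2) (K * s) s := by
      have := ((hasDerivAt_pow 2 s).const_mul K).div_const 2
      refine this.congr_deriv ?_
      norm_num
      ring
    exact ((hd s hs).sub h2).sub h3
  have hanti : AntitoneOn (fun s => ψ s - C * s - K * s ^ 2 / 2) (Set.Icc 0 1) := by
    refine antitoneOn_of_deriv_nonpos (convex_Icc 0 1)
      (fun s hs => (hd' s hs).continuousAt.continuousWithinAt) (fun s hs => ?_) (fun s hs => ?_)
    · exact (hd' s (interior_subset hs)).differentiableAt.differentiableWithinAt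
    · rw [(hd' s (interior_subset hs)).deriv]
      have := hb s (interior_subset hs)
      linarith
  have := hanti (Set.left_mem_Icc.2 zero_le_one) (Set.right_mem_Icc.2 zero_le_one) zero_le_one
  norm_num at this
  linarith

theorem hasDerivAt_along {φ : E → ℝ} {g x d : E} {s : ℝ} (h : HasGradientAt φ g (x + s • d)) :
    HasDerivAt (fun s : ℝ => φ (x + s • d)) (inner ℝ g d) s := by
  have h1 : HasDerivAt (fun s : ℝ => x + s • d) d s := by
    simpa using ((hasDerivAt_id s).smul_const d).const_add x
  have := h.hasFDerivAt.comp_hasDerivAt s h1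
  simpa [Function.comp_def] using this

theorem abs_sub_inner_le_of_lipschitz_gradient {D : Set E} (hD : Convex ℝ D) {φ : E → ℝ}
    {G : E → E} {L : ℝ} (hG : ∀ z ∈ D, HasGradientAt φ (G z) z) {x x' : E} (hx : x ∈ D)
    (hx' : x' ∈ D) (hL : ∀ z ∈ D, ‖G z - G x‖ ≤ L * ‖z - x‖) :
    |φ x' - φ x - inner ℝ (G x) (x' - x)| ≤ L / 2 * ‖x' - x‖ ^ 2 := by
  have hmem : ∀ s ∈ Set.Icc (0 : ℝ) 1, x + s • (x' - x) ∈ D := fun s hs =>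
    hD.add_smul_sub_mem hx hx' hs
  have hb : ∀ s ∈ Set.Icc (0 : ℝ) 1,
      |inner ℝ (G (x + s • (x' - x)) - G x) (x' - x)| ≤ L * ‖x' - x‖ ^ 2 * s := by
    intro s hs
    have h1 := hL _ (hmem s hs)
    rw [add_sub_cancel_left, norm_smul, Real.norm_eq_abs, abs_of_nonneg hs.1] at h1
    refine (abs_real_inner_le_norm _ _).trans ?_
    have := mul_le_mul_of_nonneg_right h1 (norm_nonneg (x' - x))
    linarith
  have h1 := sub_le_of_deriv_le_affine (ψ := fun s : ℝ => φ (x + s • (x' - x)))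
    (C := inner ℝ (G x) (x' - x)) (K := L * ‖x' - x‖ ^ 2)
    (fun s hs => hasDerivAt_along (hG _ (hmem s hs))) (fun s hs => by
      have := le_of_abs_le (hb s hs)
      rw [inner_sub_left] at this
      linarith)
  have h2 := sub_le_of_deriv_le_affine (ψ := fun s : ℝ => -φ (x + s • (x' - x)))
    (C := -inner ℝ (G x) (x' - x)) (K := L * ‖x' - x‖ ^ 2)
    (fun s hs => (hasDerivAt_along (hG _ (hmem s hs))).neg) (fun s hs => by
      have := neg_le_of_abs_le (hb s hs)
      rw [inner_sub_left] at this
      linarith)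
  simp only [one_smul, zero_smul, add_zero, add_sub_cancel] at h1 h2
  rw [abs_le]
  constructor <;> linarith

theorem le_of_strongly_monotone_gradient {D : Set E} (hD : Convex ℝ D) {φ : E → ℝ}
    {G : E → E} {μ : ℝ} (hG : ∀ z ∈ D, HasGradientAt φ (G z) z)
    (hmono : ∀ y ∈ D, ∀ y' ∈ D, inner ℝ (y - y') (G y - G y') ≤ -μ * ‖y - y'‖ ^ 2)
    {y y' : E} (hy : y ∈ D) (hy' : y' ∈ D) :
    φ y' ≤ φ y + inner ℝ (G y) (y' - y) - μ / 2 * ‖y' - y‖ ^ 2 := by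
  have hmem : ∀ s ∈ Set.Icc (0 : ℝ) 1, y + s • (y' - y) ∈ D := fun s hs =>
    hD.add_smul_sub_mem hy hy' hs
  have h1 := sub_le_of_deriv_le_affine (ψ := fun s : ℝ => φ (y + s • (y' - y)))
    (C := inner ℝ (G y) (y' - y)) (K := -μ * ‖y' - y‖ ^ 2)
    (fun s hs => hasDerivAt_along (hG _ (hmem s hs))) (fun s hs => by
      rcases eq_or_lt_of_le hs.1 with h0 | h0
      · rw [← h0]; simp
      have h2 := hmono _ (hmem s hs) y hy
      rw [add_sub_cancel_left, norm_smul, Real.norm_eq_abs, abs_of_nonneg hs.1,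
        real_inner_smul_left, inner_sub_right] at h2
      rw [real_inner_comm (y' - y), real_inner_comm (y' - y)]
      have h3 : s * (inner ℝ (y' - y) (G (y + s • (y' - y))) - inner ℝ (y' - y) (G y))
        ≤ s * (-μ * ‖y' - y‖ ^ 2 * s) := by linarith
      have := le_of_mul_le_mul_left h3 h0
      linarith)
  simp only [one_smul, zero_smul, add_zero, add_sub_cancel] at h1
  linarith

end Calculus

/-! ### Partial gradients -/

section Partial

variable {n₁ n₂ : ℕ} {f : PairVec n₁ n₂ → ℝ} {L : ℝ} {Z : Set (PairVec n₁ n₂)}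

theorem pair_sub (x x' : Vec n₁) (y y' : Vec n₂) :
    pair x y - pair x' y' = pair (x - x') (y - y') := rfl

theorem norm_sq_pair (x : Vec n₁) (y : Vec n₂) : ‖pair x y‖ ^ 2 = ‖x‖ ^ 2 + ‖y‖ ^ 2 :=
  WithLp.prod_norm_sq_eq_of_L2 _

theorem hasGradientAt_fst {x : Vec n₁} {y : Vec n₂} (h : DifferentiableAt ℝ f (pair x y)) :
    HasGradientAt (fun x' => f (pair x' y)) (gradient f (pair x y)).fst x := by
  have h1 : HasFDerivAt (fun x' : Vec n₁ => pair x' y)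
      (((WithLp.prodContinuousLinearEquiv 2 ℝ (Vec n₁) (Vec n₂)).symm :
        (Vec n₁ × Vec n₂) →L[ℝ] PairVec n₁ n₂) ∘L (ContinuousLinearMap.inl ℝ _ _)) x :=
    ((WithLp.prodContinuousLinearEquiv 2 ℝ (Vec n₁) (Vec n₂)).symm.hasFDerivAt).comp x
      (hasFDerivAt_prodMk_left x y)
  have h0 := h.hasGradientAt
  generalize gradient f (pair x y) = g at h0 ⊢
  have h2 := h0.hasFDerivAt.comp x h1
  rw [hasGradientAt_iff_hasFDerivAt]
  refine h2.congr_fderiv ?_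
  ext v
  simp [WithLp.prod_inner_apply]

theorem hasGradientAt_snd {x : Vec n₁} {y : Vec n₂} (h : DifferentiableAt ℝ f (pair x y)) :
    HasGradientAt (fun y' => f (pair x y')) (gradient f (pair x y)).snd y := by
  have h1 : HasFDerivAt (fun y' : Vec n₂ => pair x y')
      (((WithLp.prodContinuousLinearEquiv 2 ℝ (Vec n₁) (Vec n₂)).symm :
        (Vec n₁ × Vec n₂) →L[ℝ] PairVec n₁ n₂) ∘L (ContinuousLinearMap.inr ℝ _ _)) y :=
    ((WithLp.prodContinuousLinearEquiv 2 ℝ (Vec n₁) (Vec n₂)).symm.hasFDerivAt).comp y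
      (hasFDerivAt_prodMk_right x y)
  have h0 := h.hasGradientAt
  generalize gradient f (pair x y) = g at h0 ⊢
  have h2 := h0.hasFDerivAt.comp y h1
  rw [hasGradientAt_iff_hasFDerivAt]
  refine h2.congr_fderiv ?_
  ext v
  simp [WithLp.prod_inner_apply]

theorem IsSmoothOn.hasGradientAt_gradX (hf : IsSmoothOn f L Z) {x : Vec n₁} {y : Vec n₂}
    (h : pair x y ∈ Z) : HasGradientAt (fun x' => f (pair x' y)) (gradX f x y) x := by
  have h1 := hasGradientAt_fst (hf.1 _ h)
  rwa [gradX, h1.gradient]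

theorem IsSmoothOn.hasGradientAt_gradY (hf : IsSmoothOn f L Z) {x : Vec n₁} {y : Vec n₂}
    (h : pair x y ∈ Z) : HasGradientAt (fun y' => f (pair x y')) (gradY f x y) y := by
  have h1 := hasGradientAt_snd (hf.1 _ h)
  rwa [gradY, h1.gradient]

theorem IsSmoothOn.norm_sq_gradX_sub_le (hf : IsSmoothOn f L Z) {x x' : Vec n₁}
    {y y' : Vec n₂} (h : pair x y ∈ Z) (h' : pair x' y' ∈ Z) :
    ‖gradX f x y - gradX f x' y'‖ ^ 2 ≤ L ^ 2 * (‖x - x'‖ ^ 2 + ‖y - y'‖ ^ 2) := by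
  have h1 := hf.2 _ h _ h'
  rw [gradX, gradX, (hasGradientAt_fst (hf.1 _ h)).gradient,
    (hasGradientAt_fst (hf.1 _ h')).gradient, ← norm_sq_pair, ← pair_sub, ← mul_pow]
  refine le_trans ?_ (pow_le_pow_left₀ (norm_nonneg _) h1 2)
  have h2 := WithLp.prod_norm_sq_eq_of_L2 (gradient f (pair x y) - gradient f (pair x' y'))
  rw [h2]
  exact le_add_of_nonneg_right (sq_nonneg _)

theorem IsSmoothOn.norm_gradX_sub_le_left (hf : IsSmoothOn f L Z) (hL : 0 ≤ L) {x x' : Vec n₁}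
    {y : Vec n₂} (h : pair x y ∈ Z) (h' : pair x' y ∈ Z) :
    ‖gradX f x y - gradX f x' y‖ ≤ L * ‖x - x'‖ := by
  have h1 := hf.norm_sq_gradX_sub_le h h'
  rw [sub_self, norm_zero, zero_pow two_ne_zero, add_zero, ← mul_pow] at h1
  exact (sq_le_sq₀ (norm_nonneg _) (by positivity)).1 h1

theorem IsSmoothOn.norm_gradX_sub_le_right (hf : IsSmoothOn f L Z) (hL : 0 ≤ L) {x : Vec n₁}
    {y y' : Vec n₂} (h : pair x y ∈ Z) (h' : pair x y' ∈ Z) :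
    ‖gradX f x y - gradX f x y'‖ ≤ L * ‖y - y'‖ := by
  have h1 := hf.norm_sq_gradX_sub_le h h'
  rw [sub_self, norm_zero, zero_pow two_ne_zero, zero_add, ← mul_pow] at h1
  exact (sq_le_sq₀ (norm_nonneg _) (by positivity)).1 h1

/-- Mixed second differences of an `L`-smooth function. -/
theorem IsSmoothOn.mixed_difference_le (hf : IsSmoothOn f L Z) (hL : 0 ≤ L) {D : Set (Vec n₁)}
    (hD : Convex ℝ D) {x x' : Vec n₁} {y y' : Vec n₂} (hx : x ∈ D) (hx' : x' ∈ D)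
    (hy : ∀ z ∈ D, pair z y ∈ Z) (hy' : ∀ z ∈ D, pair z y' ∈ Z) :
    f (pair x' y) - f (pair x y) - (f (pair x' y') - f (pair x y'))
      ≤ L * ‖y - y'‖ * ‖x' - x‖ := by
  have hmem : ∀ s ∈ Set.Icc (0 : ℝ) 1, x + s • (x' - x) ∈ D := fun s hs =>
    hD.add_smul_sub_mem hx hx' hs
  have h1 := sub_le_of_deriv_le_affine
    (ψ := fun s : ℝ => f (pair (x + s • (x' - x)) y) - f (pair (x + s • (x' - x)) y'))
    (C := L * ‖y - y'‖ * ‖x' - x‖) (K := 0)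
    (fun s hs => (hasDerivAt_along (hf.hasGradientAt_gradX (hy _ (hmem s hs)))).sub
      (hasDerivAt_along (hf.hasGradientAt_gradX (hy' _ (hmem s hs))))) (fun s hs => by
      rw [← inner_sub_left, zero_mul, add_zero]
      refine (real_inner_le_norm _ _).trans ?_
      gcongr
      exact hf.norm_gradX_sub_le_right hL (hy _ (hmem s hs)) (hy' _ (hmem s hs)))
  simp only [one_smul, zero_smul, add_zero, add_sub_cancel] at h1
  linarith

end Partial

/-! ### The inner maximization problem -/

/-- The assumptions on the objective functions of the minimax problem. -/
structure IsProblem {m n₁ n₂ : ℕ} (f : Fin m → PairVec n₁ n₂ → ℝ) (g : Vec n₁ → EReal)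
    (h : Vec n₂ → EReal) (L μ : ℝ) (Z : Set (PairVec n₁ n₂)) : Prop where
  pos : 0 < m
  closed_g : IsClosedConvex g
  closed_h : IsClosedConvex h
  nonempty_h : (dom h).Nonempty
  mu_pos : 0 < μ
  mu_le : μ ≤ L
  mem : ∀ x ∈ dom g, ∀ y ∈ dom h, pair x y ∈ Z
  smooth : ∀ i, IsSmoothOn (f i) L Z
  concave : ∀ i, IsStronglyConcaveIn (f i) μ (dom g) (dom h)

/-! ### The strongly concave maximization problem of a single agent. -/

section Row

variable {n₁ n₂ : ℕ}

/-- `f(x, y) - h(y) - ⟨c, y⟩`, meaningful for `y ∈ dom h`. -/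
def rowObj (f : PairVec n₁ n₂ → ℝ) (h : Vec n₂ → EReal) (x : Vec n₁) (c y : Vec n₂) : ℝ :=
  f (pair x y) - (h y).toReal - inner ℝ c y

/-- The maximizer of `rowObj f h x c` over `dom h`. -/
def rowArg (f : PairVec n₁ n₂ → ℝ) (h : Vec n₂ → EReal) (x : Vec n₁) (c : Vec n₂) : Vec n₂ :=
  Classical.epsilon fun z => z ∈ dom h ∧ ∀ y ∈ dom h, rowObj f h x c y ≤ rowObj f h x c z

variable {m : ℕ} {f : Fin m → PairVec n₁ n₂ → ℝ} {g : Vec n₁ → EReal} {h : Vec n₂ → EReal}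
  {L μ : ℝ} {Z : Set (PairVec n₁ n₂)}

theorem IsProblem.L_pos (H : IsProblem f g h L μ Z) : 0 < L := H.mu_pos.trans_le H.mu_le

theorem IsProblem.strong_convexity (H : IsProblem f g h L μ Z) (i : Fin m) {x : Vec n₁}
    (hx : x ∈ dom g) (c : Vec n₂) : ∀ y ∈ dom h, ∀ y' ∈ dom h,
      (-f i (pair x y) + inner ℝ c y) + inner ℝ (c - gradY (f i) x y) (y' - y)
        + μ / 2 * ‖y' - y‖ ^ 2 ≤ -f i (pair x y') + inner ℝ c y' := by
  intro y hy y' hy'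
  have h1 := le_of_strongly_monotone_gradient H.closed_h.convex_dom
    (fun z hz => (H.smooth i).hasGradientAt_gradY (H.mem x hx z hz)) (H.concave i x hx) hy hy'
  rw [inner_sub_left, inner_sub_right c]
  linarith

theorem IsProblem.row_growth (H : IsProblem f g h L μ Z) (i : Fin m) {x : Vec n₁}
    (hx : x ∈ dom g) {c z : Vec n₂} (hz : z ∈ dom h)
    (hmax : ∀ y ∈ dom h, rowObj (f i) h x c y ≤ rowObj (f i) h x c z) {y : Vec n₂}
    (hy : y ∈ dom h) : rowObj (f i) h x c y + μ / 2 * ‖y - z‖ ^ 2 ≤ rowObj (f i) h x c z := by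
  have h1 := H.closed_h.growth (H.strong_convexity i hx c) hz (fun y hy => by
    have := hmax y hy
    simp only [rowObj] at this
    linarith) hy
  simp only [rowObj]
  linarith

theorem IsProblem.rowArg_spec (H : IsProblem f g h L μ Z) (i : Fin m) {x : Vec n₁}
    (hx : x ∈ dom g) (c : Vec n₂) :
    rowArg (f i) h x c ∈ dom h ∧
      ∀ y ∈ dom h, rowObj (f i) h x c y ≤ rowObj (f i) h x c (rowArg (f i) h x c) := by
  have hc : ContinuousOn (fun y => -f i (pair x y) + inner ℝ c y) (dom h) := by
    intro y hy
    have h1 := ((H.smooth i).hasGradientAt_gradY (H.mem x hx y hy)).continuousAt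
    have h2 : ContinuousAt (fun y : Vec n₂ => (inner ℝ c y : ℝ)) y := by fun_prop
    exact (h1.neg.add h2).continuousWithinAt
  obtain ⟨z, hz, hmin⟩ := H.closed_h.exists_min H.nonempty_h H.mu_pos hc
    (H.strong_convexity i hx c)
  refine Classical.epsilon_spec (p := fun z => z ∈ dom h ∧ ∀ y ∈ dom h,
    rowObj (f i) h x c y ≤ rowObj (f i) h x c z) ⟨z, hz, fun y hy => ?_⟩
  have h1 := hmin y hy
  have h2 : 0 ≤ μ / 2 * ‖y - z‖ ^ 2 := by have := H.mu_pos; positivity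
  simp only [rowObj]
  linarith

theorem IsProblem.rowArg_mem (H : IsProblem f g h L μ Z) (i : Fin m) {x : Vec n₁}
    (hx : x ∈ dom g) (c : Vec n₂) : rowArg (f i) h x c ∈ dom h := (H.rowArg_spec i hx c).1

theorem IsProblem.rowArg_growth (H : IsProblem f g h L μ Z) (i : Fin m) {x : Vec n₁}
    (hx : x ∈ dom g) (c : Vec n₂) {y : Vec n₂} (hy : y ∈ dom h) :
    rowObj (f i) h x c y + μ / 2 * ‖y - rowArg (f i) h x c‖ ^ 2
      ≤ rowObj (f i) h x c (rowArg (f i) h x c) :=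
  H.row_growth i hx (H.rowArg_mem i hx c) (H.rowArg_spec i hx c).2 hy

/-- Sensitivity of the maximizer of a row objective. -/
theorem IsProblem.rowArg_sensitivity (H : IsProblem f g h L μ Z) (i : Fin m) {x x' : Vec n₁}
    (hx : x ∈ dom g) (hx' : x' ∈ dom g) (c c' : Vec n₂) :
    μ * ‖rowArg (f i) h x c - rowArg (f i) h x' c'‖ ^ 2
      ≤ L * (‖x - x'‖ * ‖rowArg (f i) h x c - rowArg (f i) h x' c'‖)
        - inner ℝ (c - c') (rowArg (f i) h x c - rowArg (f i) h x' c') := by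
  have hy := H.rowArg_mem i hx c
  have hy' := H.rowArg_mem i hx' c'
  -- Adding the growth inequalities at the two maximizers cancels `h`. What remains is a mixed
  -- second difference of `fᵢ` and the pairing with `c - c'`, against the full modulus `μ`.
  have h1 := H.rowArg_growth i hx c hy'
  have h2 := H.rowArg_growth i hx' c' hy
  have h3 := (H.smooth i).mixed_difference_le H.L_pos.le H.closed_g.convex_dom hx' hx
    (fun z hz => H.mem z hz _ hy) (fun z hz => H.mem z hz _ hy')
  rw [norm_sub_rev] at h1
  simp only [rowObj] at h1 h2
  simp only [inner_sub_left, inner_sub_right]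
  linarith

/-- A point with supergradient `ξ` is an exact maximizer once the objective is tilted by `ξ`. Growth
for the tilted and the untilted problem gives `μ‖y - z‖² ≤ ⟨ξ, z - y⟩`, so the stopping test of the
algorithm controls the distance to the true maximizer. -/
theorem IsProblem.rowArg_of_supergradient (H : IsProblem f g h L μ Z) (i : Fin m) {x : Vec n₁}
    (hx : x ∈ dom g) {c y ξ : Vec n₂} (hξ : ξ ∈ superdifferential
      (fun y => (f i (pair x y) : EReal) - h y - ((inner ℝ c y : ℝ) : EReal)) y) :
    y ∈ dom h ∧ μ * ‖y - rowArg (f i) h x c‖ ≤ ‖ξ‖ := by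
  have hval : ∀ y ∈ dom h, (f i (pair x y) : EReal) - h y - ((inner ℝ c y : ℝ) : EReal)
      = (rowObj (f i) h x c y : EReal) := by
    intro y hy
    rw [← H.closed_h.coe_toReal hy, rowObj]
    push_cast
    rfl
  obtain ⟨y₀, hy₀⟩ := H.nonempty_h
  -- Outside `dom h` the objective is `⊥`, and no supergradient inequality can hold against the
  -- finite value at `y₀`.
  have hy : y ∈ dom h := by
    by_contra hcon
    have htop : h y = ⊤ := by simpa [dom] using hcon
    have h1 := hξ y₀
    simp only [hval y₀ hy₀, htop] at h1
    rw [EReal.sub_top, EReal.bot_sub, EReal.bot_add] at h1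
    exact absurd h1 (not_le.2 (EReal.bot_lt_coe _))
  refine ⟨hy, ?_⟩
  have hmax : ∀ y' ∈ dom h, rowObj (f i) h x (c + ξ) y' ≤ rowObj (f i) h x (c + ξ) y := by
    intro y' hy'
    have h1 := hξ y'
    simp only [hval y hy, hval y' hy'] at h1
    have h2 : rowObj (f i) h x c y' ≤ rowObj (f i) h x c y + inner ℝ ξ (y' - y) := by
      exact_mod_cast h1
    simp only [rowObj, inner_add_left, inner_sub_right] at h2 ⊢
    linarith
  have hz := H.rowArg_mem i hx c
  have h1 := H.row_growth i hx hy hmax hz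
  have h2 := H.rowArg_growth i hx c hy
  set z := rowArg (f i) h x c
  rw [norm_sub_rev] at h1
  have h3 : μ * ‖y - z‖ ^ 2 ≤ ‖ξ‖ * ‖y - z‖ := by
    have h4 := real_inner_le_norm ξ (z - y)
    rw [norm_sub_rev z y] at h4
    simp only [rowObj, inner_add_left, inner_sub_right] at h1 h2 h4
    linarith
  rcases eq_or_lt_of_le (norm_nonneg (y - z)) with h0 | h0
  · rw [← h0]; simp
  · exact le_of_mul_le_mul_right (by linarith) h0

end Row

/-! ### The value function `P`: separation into rows and two-sided quadratic bounds. -/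

section Value

variable {m n₁ n₂ : ℕ} {f : Fin m → PairVec n₁ n₂ → ℝ} {g : Vec n₁ → EReal} {h : Vec n₂ → EReal}
  {L μ : ℝ} {Z : Set (PairVec n₁ n₂)} {G : SimpleGraph (Fin m)} {W : Matrix (Fin m) (Fin m) ℝ}

/-- The linear term in the objective of agent `i`. -/
def dualTerm (W : Matrix (Fin m) (Fin m) ℝ) (L : ℝ) (Λ : Stack m n₂) (i : Fin m) : Vec n₂ :=
  (L * √(m : ℝ) / 2) • dualRow W Λ i

/-- The rows maximizing the local objectives. -/
def argY (f : Fin m → PairVec n₁ n₂ → ℝ) (h : Vec n₂ → EReal) (W : Matrix (Fin m) (Fin m) ℝ)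
    (L : ℝ) (X : Stack m n₁) (Λ : Stack m n₂) : Stack m n₂ :=
  WithLp.toLp 2 fun i => rowArg (f i) h (X i) (dualTerm W L Λ i)

/-- The real value of `P(x, Λ)`. -/
def valP (f : Fin m → PairVec n₁ n₂ → ℝ) (h : Vec n₂ → EReal) (W : Matrix (Fin m) (Fin m) ℝ)
    (L : ℝ) (x : Vec n₁) (Λ : Stack m n₂) : ℝ :=
  (1 / (m : ℝ)) * ∑ i, rowObj (f i) h x (dualTerm W L Λ i) (argY f h W L (rep m x) Λ i)

/-- The gradient of `P` with respect to `x`. -/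
def gradPX (f : Fin m → PairVec n₁ n₂ → ℝ) (h : Vec n₂ → EReal) (W : Matrix (Fin m) (Fin m) ℝ)
    (L : ℝ) (x : Vec n₁) (Λ : Stack m n₂) : Vec n₁ :=
  (1 / (m : ℝ)) • ∑ i, gradX (f i) x (argY f h W L (rep m x) Λ i)

/-- The gradient of `P` with respect to `Λ`. -/
def gradPL (f : Fin m → PairVec n₁ n₂ → ℝ) (h : Vec n₂ → EReal) (W : Matrix (Fin m) (Fin m) ℝ)
    (L : ℝ) (x : Vec n₁) (Λ : Stack m n₂) : Stack m n₂ :=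
  -((L / (2 * √(m : ℝ))) • matMul (W - 1) (argY f h W L (rep m x) Λ))

theorem argY_apply (X : Stack m n₁) (Λ : Stack m n₂) (i : Fin m) :
    argY f h W L X Λ i = rowArg (f i) h (X i) (dualTerm W L Λ i) := rfl

/-- The agents' factor `L√m/2`, averaged with `1/m`, becomes the factor `L/(2√m)` of `Φ`. -/
theorem mean_inner_dualTerm (hm : 0 < m) (Λ Y : Stack m n₂) :
    (1 / (m : ℝ)) * ∑ i, (inner ℝ (dualTerm W L Λ i) (Y i) : ℝ)
      = L / (2 * √(m : ℝ)) * inner ℝ Λ (matMul (W - 1) Y) := by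
  simp only [dualTerm, real_inner_smul_left, ← Finset.mul_sum, sum_inner_dualRow]
  have h1 : √(m : ℝ) ≠ 0 := by positivity
  have h2 : (m : ℝ) = √(m : ℝ) * √(m : ℝ) := (Real.mul_self_sqrt (by positivity)).symm
  nth_rw 1 [h2]
  field_simp

theorem dualTerm_sub (Λ Λ' : Stack m n₂) (i : Fin m) :
    dualTerm W L (Λ - Λ') i = dualTerm W L Λ i - dualTerm W L Λ' i := by
  simp only [dualTerm, dualRow_sub, smul_sub]

theorem sum_mul_le_norm_mul_norm {k : ℕ} (X : Stack m k) (Y : Stack m n₂) :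
    ∑ i, ‖X i‖ * ‖Y i‖ ≤ ‖X‖ * ‖Y‖ := by
  refine le_of_sq_le_sq ?_ (by positivity)
  rw [mul_pow, norm_sq_stack, norm_sq_stack]
  exact Finset.sum_mul_sq_le_sq_mul_sq _ _ _

theorem sum_norm_le (X : Stack m n₂) : ∑ i, ‖X i‖ ≤ √(m : ℝ) * ‖X‖ := by
  refine le_of_sq_le_sq ?_ (by positivity)
  rw [mul_pow, norm_sq_stack, Real.sq_sqrt (by positivity)]
  simpa using Finset.sum_mul_sq_le_sq_mul_sq Finset.univ (fun _ => (1 : ℝ)) (fun i => ‖X i‖)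

theorem IsProblem.argY_mem (H : IsProblem f g h L μ Z) {X : Stack m n₁} (hX : ∀ i, X i ∈ dom g)
    (Λ : Stack m n₂) (i : Fin m) : argY f h W L X Λ i ∈ dom h :=
  H.rowArg_mem i (hX i) _

/-- The maximizers depend on `(X, Λ)` in a Lipschitz continuous way. -/
theorem IsProblem.norm_argY_sub_le (H : IsProblem f g h L μ Z) (hW : IsMixing G W)
    {X X' : Stack m n₁} (hX : ∀ i, X i ∈ dom g) (hX' : ∀ i, X' i ∈ dom g) (Λ Λ' : Stack m n₂) :
    ‖argY f h W L X Λ - argY f h W L X' Λ'‖ ≤ L / μ * (‖X - X'‖ + √(m : ℝ) * ‖Λ - Λ'‖) := by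
  set D := argY f h W L X Λ - argY f h W L X' Λ' with hD
  have hL := H.L_pos
  have hμ := H.mu_pos
  have h1 : μ * ‖D‖ ^ 2 ≤ L * (‖X - X'‖ * ‖D‖)
      - ∑ i, (inner ℝ (dualTerm W L (Λ - Λ') i) (D i) : ℝ) := by
    refine le_trans ?_ (sub_le_sub_right (mul_le_mul_of_nonneg_left
      (sum_mul_le_norm_mul_norm (X - X') D) hL.le) _)
    rw [norm_sq_stack, Finset.mul_sum, Finset.mul_sum, ← Finset.sum_sub_distrib]
    refine Finset.sum_le_sum fun i _ => ?_
    rw [dualTerm_sub]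
    exact H.rowArg_sensitivity i (hX i) (hX' i) _ _
  have hm := H.pos
  have h2 := mean_inner_dualTerm (W := W) (L := L) hm (Λ - Λ') D
  have h3 : |inner ℝ (Λ - Λ') (matMul (W - 1) D)| ≤ ‖Λ - Λ'‖ * (2 * ‖D‖) :=
    (abs_real_inner_le_norm _ _).trans
      (mul_le_mul_of_nonneg_left (hW.norm_matMul_sub_one_le D) (norm_nonneg _))
  have hs : 0 < √(m : ℝ) := by positivity
  have h4 : ∑ i, (inner ℝ (dualTerm W L (Λ - Λ') i) (D i) : ℝ)
      = L * √(m : ℝ) / 2 * inner ℝ (Λ - Λ') (matMul (W - 1) D) := by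
    rw [← sum_inner_dualRow, Finset.mul_sum]
    simp only [dualTerm, real_inner_smul_left]
  have h5 : -∑ i, (inner ℝ (dualTerm W L (Λ - Λ') i) (D i) : ℝ)
      ≤ L * √(m : ℝ) * ‖Λ - Λ'‖ * ‖D‖ := by
    rw [h4]
    have h6 := mul_le_mul_of_nonneg_left (neg_le_of_abs_le h3)
      (show 0 ≤ L * √(m : ℝ) / 2 by positivity)
    linarith
  rw [div_mul_eq_mul_div, le_div_iff₀ hμ]
  rcases eq_or_lt_of_le (norm_nonneg D) with h0 | h0
  · rw [← h0]; simp; positivity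
  · refine le_of_mul_le_mul_right ?_ h0
    linarith

theorem ereal_coe_sum {ι : Type*} (s : Finset ι) (a : ι → ℝ) :
    ((∑ i ∈ s, a i : ℝ) : EReal) = ∑ i ∈ s, (a i : EReal) :=
  map_sum (⟨⟨Real.toEReal, EReal.coe_zero⟩, EReal.coe_add⟩ : ℝ →+ EReal) a s

theorem bigPhi_eq (H : IsProblem f g h L μ Z) (X : Stack m n₁) (Λ : Stack m n₂) {Y : Stack m n₂}
    (hY : ∀ i, Y i ∈ dom h) : bigPhi f h W L X Λ Y
      = ((1 / (m : ℝ) * ∑ i, rowObj (f i) h (X i) (dualTerm W L Λ i) (Y i) : ℝ) : EReal) := by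
  have h1 : ∑ i, ((f i (pair (X i) (Y i)) : EReal) - h (Y i))
      = ((∑ i, (f i (pair (X i) (Y i)) - (h (Y i)).toReal) : ℝ) : EReal) := by
    rw [ereal_coe_sum]
    refine Finset.sum_congr rfl fun i _ => ?_
    rw [EReal.coe_sub, H.closed_h.coe_toReal (hY i)]
  rw [bigPhi, h1, ← mean_inner_dualTerm H.pos]
  simp only [rowObj, Finset.sum_sub_distrib, mul_sub]
  norm_cast
  rw [mul_sub]

/-- `⊥` absorbs every summand in `EReal`, so the supremum defining `P` may be taken over `Y` with
all rows in `dom h`. -/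
theorem bigPhi_eq_bot (H : IsProblem f g h L μ Z) (X : Stack m n₁) (Λ : Stack m n₂)
    {Y : Stack m n₂} {i : Fin m} (hY : Y i ∉ dom h) : bigPhi f h W L X Λ Y = ⊥ := by
  have hm : (0 : ℝ) < 1 / (m : ℝ) := by have := H.pos; positivity
  have htop : h (Y i) = ⊤ := by simpa [dom] using hY
  have h1 : ∑ i, ((f i (pair (X i) (Y i)) : EReal) - h (Y i)) = ⊥ := by
    rw [← Finset.add_sum_erase _ _ (Finset.mem_univ i), htop, EReal.sub_top, EReal.bot_add]
  rw [bigPhi, h1, EReal.coe_mul_bot_of_pos hm, EReal.bot_sub]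

theorem IsProblem.bigP_eq (H : IsProblem f g h L μ Z) {x : Vec n₁} (hx : x ∈ dom g)
    (Λ : Stack m n₂) : bigP f h W L x Λ = (valP f h W L x Λ : EReal) := by
  have hmem := H.argY_mem (W := W) (X := rep m x) (fun _ => hx) Λ
  have hm : (0 : ℝ) < 1 / (m : ℝ) := by have := H.pos; positivity
  apply le_antisymm
  · refine iSup_le fun Y => ?_
    by_cases hY : ∀ i, Y i ∈ dom h
    · rw [bigPhi_eq H _ _ hY]
      refine EReal.coe_le_coe_iff.2 (mul_le_mul_of_nonneg_left ?_ hm.le)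
      exact Finset.sum_le_sum fun i _ => (H.rowArg_spec i hx _).2 _ (hY i)
    · push Not at hY
      obtain ⟨i, hi⟩ := hY
      rw [bigPhi_eq_bot H _ _ hi]
      exact bot_le
  · refine le_trans (le_of_eq ?_) (le_iSup _ (argY f h W L (rep m x) Λ))
    rw [bigPhi_eq H _ _ hmem]
    rfl

theorem mean_inner_dualTerm_argY (hm : 0 < m) (x : Vec n₁) (Λ D : Stack m n₂) :
    (inner ℝ (gradPL f h W L x Λ) D : ℝ)
      = -((1 / (m : ℝ)) * ∑ i, inner ℝ (dualTerm W L D i) (argY f h W L (rep m x) Λ i)) := by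
  rw [mean_inner_dualTerm hm, gradPL, inner_neg_left, real_inner_smul_left, real_inner_comm]

theorem inner_gradPX (x : Vec n₁) (Λ : Stack m n₂) (d : Vec n₁) :
    (inner ℝ (gradPX f h W L x Λ) d : ℝ)
      = (1 / (m : ℝ)) * ∑ i, inner ℝ (gradX (f i) x (argY f h W L (rep m x) Λ i)) d := by
  rw [gradPX, real_inner_smul_left, sum_inner]

/-- The maximizer at `(x, Λ)` is a competitor at `(x', Λ')`. Since `Λ` enters linearly, only the
smoothness error in `x` is lost. -/
theorem IsProblem.valP_lower (H : IsProblem f g h L μ Z) {x x' : Vec n₁} (hx : x ∈ dom g)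
    (hx' : x' ∈ dom g) (Λ Λ' : Stack m n₂) :
    valP f h W L x Λ + inner ℝ (gradPX f h W L x Λ) (x' - x)
      + inner ℝ (gradPL f h W L x Λ) (Λ' - Λ) - L / 2 * ‖x' - x‖ ^ 2 ≤ valP f h W L x' Λ' := by
  have hm := H.pos
  have hm' : (0 : ℝ) < 1 / (m : ℝ) := by positivity
  rw [mean_inner_dualTerm_argY hm, inner_gradPX, valP, valP]
  have e : L / 2 * ‖x' - x‖ ^ 2 = (1 / (m : ℝ)) * ∑ _i : Fin m, L / 2 * ‖x' - x‖ ^ 2 := by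
    simp; field_simp
  rw [e, ← sub_eq_add_neg, ← mul_add, ← mul_sub, ← mul_sub, ← Finset.sum_add_distrib,
    ← Finset.sum_sub_distrib, ← Finset.sum_sub_distrib]
  refine mul_le_mul_of_nonneg_left (Finset.sum_le_sum fun i _ => ?_) hm'.le
  have hy := H.argY_mem (W := W) (X := rep m x) (fun _ => hx) Λ i
  have h1 := (H.rowArg_spec i hx' (dualTerm W L Λ' i)).2 _ hy
  have h2 := abs_sub_inner_le_of_lipschitz_gradient H.closed_g.convex_dom
    (fun z hz => (H.smooth i).hasGradientAt_gradX (H.mem z hz _ hy)) hx hx'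
    (fun z hz => (H.smooth i).norm_gradX_sub_le_left H.L_pos.le (H.mem z hz _ hy)
      (H.mem x hx _ hy))
  have h3 := neg_le_of_abs_le h2
  rw [argY_apply (rep m x') Λ', rep_apply]
  refine le_trans ?_ h1
  simp only [rowObj, dualTerm_sub, inner_sub_left]
  linarith

/-- Here the new maximizer `Y'` is a competitor at `(x, Λ)`, where strong concavity costs it `μ/2 ·
‖Y' - Y‖²` in the sum over rows. This cost absorbs the cross terms between `Y' - Y` and the
increments of `x` and `Λ`, so no Lipschitz bound for the maximizer is needed. -/
theorem IsProblem.valP_upper (H : IsProblem f g h L μ Z) (hW : IsMixing G W) {x x' : Vec n₁}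
    (hx : x ∈ dom g) (hx' : x' ∈ dom g) (Λ Λ' : Stack m n₂) :
    valP f h W L x' Λ' ≤ valP f h W L x Λ + inner ℝ (gradPX f h W L x Λ) (x' - x)
      + inner ℝ (gradPL f h W L x Λ) (Λ' - Λ) + (L / 2 + L ^ 2 / μ) * ‖x' - x‖ ^ 2
      + L ^ 2 / μ * ‖Λ' - Λ‖ ^ 2 := by
  have hm := H.pos
  have hL := H.L_pos
  have hμ := H.mu_pos
  have hm' : (0 : ℝ) < 1 / (m : ℝ) := by positivity
  set Y := argY f h W L (rep m x) Λ with hY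
  set Y' := argY f h W L (rep m x') Λ' with hY'
  have hrow : ∀ i, rowObj (f i) h x' (dualTerm W L Λ' i) (Y' i)
      ≤ rowObj (f i) h x (dualTerm W L Λ i) (Y i) + inner ℝ (gradX (f i) x (Y i)) (x' - x)
        - inner ℝ (dualTerm W L (Λ' - Λ) i) (Y i) + L / 2 * ‖x' - x‖ ^ 2
        + L * ‖x' - x‖ * ‖(Y' - Y) i‖ - inner ℝ (dualTerm W L (Λ' - Λ) i) ((Y' - Y) i)
        - μ / 2 * ‖(Y' - Y) i‖ ^ 2 := by
    intro i
    have hy := H.argY_mem (W := W) (X := rep m x) (fun _ => hx) Λ i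
    have hy' := H.argY_mem (W := W) (X := rep m x') (fun _ => hx') Λ' i
    rw [← hY] at hy
    rw [← hY'] at hy'
    have h1 := H.rowArg_growth i hx (dualTerm W L Λ i) hy'
    have h2 := abs_sub_inner_le_of_lipschitz_gradient H.closed_g.convex_dom
      (fun z hz => (H.smooth i).hasGradientAt_gradX (H.mem z hz _ hy')) hx hx'
      (fun z hz => (H.smooth i).norm_gradX_sub_le_left H.L_pos.le (H.mem z hz _ hy')
        (H.mem x hx _ hy'))
    have h3 := le_of_abs_le h2
    have h4 : inner ℝ (gradX (f i) x (Y' i) - gradX (f i) x (Y i)) (x' - x)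
        ≤ L * ‖x' - x‖ * ‖(Y' - Y) i‖ := by
      refine (real_inner_le_norm _ _).trans ?_
      have := mul_le_mul_of_nonneg_right ((H.smooth i).norm_gradX_sub_le_right hL.le
        (H.mem x hx _ hy') (H.mem x hx _ hy)) (norm_nonneg (x' - x))
      rw [PiLp.sub_apply]
      linarith
    have e : rowArg (f i) h x (dualTerm W L Λ i) = Y i := rfl
    rw [e] at h1
    simp only [rowObj, dualTerm_sub, inner_sub_left, inner_sub_right, PiLp.sub_apply] at h1 h3 h4 ⊢
    linarith
  have hsum := mul_le_mul_of_nonneg_left (Finset.sum_le_sum fun i (_ : i ∈ Finset.univ) => hrow i)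
    hm'.le
  simp only [Finset.sum_sub_distrib, Finset.sum_add_distrib, mul_sub, mul_add] at hsum
  rw [mean_inner_dualTerm hm (Λ' - Λ) (Y' - Y),
    ← Finset.mul_sum Finset.univ (fun i => ‖(Y' - Y) i‖),
    ← Finset.mul_sum Finset.univ (fun i => ‖(Y' - Y) i‖ ^ 2), ← norm_sq_stack] at hsum
  have e : (1 / (m : ℝ)) * ∑ _i : Fin m, L / 2 * ‖x' - x‖ ^ 2 = L / 2 * ‖x' - x‖ ^ 2 := by
    simp; field_simp
  rw [e] at hsum
  rw [mean_inner_dualTerm_argY hm, inner_gradPX, valP, valP]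
  set s := √(m : ℝ) with hs
  have hs0 : 0 < s := by positivity
  have hss : (m : ℝ) = s * s := (Real.mul_self_sqrt (by positivity)).symm
  set N := ‖Y' - Y‖ / s with hN
  have hND : ‖Y' - Y‖ = s * N := by rw [hN]; field_simp
  have b1 : 1 / (m : ℝ) * (L * ‖x' - x‖ * ∑ i, ‖(Y' - Y) i‖) ≤ L * ‖x' - x‖ * N := by
    have := mul_le_mul_of_nonneg_left (sum_norm_le (Y' - Y))
      (show 0 ≤ 1 / (m : ℝ) * (L * ‖x' - x‖) by positivity)
    rw [← mul_assoc]
    refine this.trans (le_of_eq ?_)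
    rw [← hs, hND, hss]
    field_simp
  have b2 : -(L / (2 * s) * inner ℝ (Λ' - Λ) (matMul (W - 1) (Y' - Y))) ≤ L * ‖Λ' - Λ‖ * N := by
    have h3 : |inner ℝ (Λ' - Λ) (matMul (W - 1) (Y' - Y))| ≤ ‖Λ' - Λ‖ * (2 * ‖Y' - Y‖) :=
      (abs_real_inner_le_norm _ _).trans
        (mul_le_mul_of_nonneg_left (hW.norm_matMul_sub_one_le _) (norm_nonneg _))
    have h6 := mul_le_mul_of_nonneg_left (neg_le_of_abs_le h3)
      (show 0 ≤ L / (2 * s) by positivity)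
    have h7 : L / (2 * s) * (‖Λ' - Λ‖ * (2 * ‖Y' - Y‖)) = L * ‖Λ' - Λ‖ * N := by
      rw [hND]; field_simp
    linarith
  have b3 : 1 / (m : ℝ) * (μ / 2 * ‖Y' - Y‖ ^ 2) = μ / 2 * N ^ 2 := by
    rw [hND, hss]; field_simp
  rw [b3] at hsum
  -- Maximizing over `N` gives `L²(α + β)²/(2μ)` with `α = ‖x' - x‖` and `β = ‖Λ' - Λ‖`, and `(α +
  -- β)² ≤ 2α² + 2β²`.
  have b4 : L * (‖x' - x‖ + ‖Λ' - Λ‖) * N - μ / 2 * N ^ 2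
      ≤ L ^ 2 / μ * (‖x' - x‖ ^ 2 + ‖Λ' - Λ‖ ^ 2) := by
    rw [div_mul_eq_mul_div (L ^ 2), le_div_iff₀ hμ]
    nlinarith [sq_nonneg (μ * N - L * (‖x' - x‖ + ‖Λ' - Λ‖)),
      mul_nonneg (sq_nonneg L) (sq_nonneg (‖x' - x‖ - ‖Λ' - Λ‖))]
  linarith

/-! ### Differentiability of the value function -/

theorem hasGradientWithinAt_of_quadratic {E : Type*} [NormedAddCommGroup E]
    [InnerProductSpace ℝ E] [CompleteSpace E] {φ : E → ℝ} {v x : E} {D : Set E} {C : ℝ}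
    (hx : x ∈ D) (hq : ∀ z ∈ D, |φ z - φ x - inner ℝ v (z - x)| ≤ C * ‖z - x‖ ^ 2) :
    HasGradientWithinAt φ v D x := by
  have h1 : (fun z => φ z - φ x - inner ℝ v (z - x)) =O[𝓝[D] x] fun z => ‖z - x‖ ^ 2 := by
    refine Asymptotics.IsBigO.of_bound C ?_
    filter_upwards [self_mem_nhdsWithin] with z hz
    rw [Real.norm_eq_abs, Real.norm_eq_abs, abs_of_nonneg (sq_nonneg ‖z - x‖)]
    exact hq z hz
  have h2 := h1.hasFDerivWithinAt (𝕜 := ℝ) hx one_lt_two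
  have h3 : HasFDerivWithinAt (fun z => φ x + inner ℝ v (z - x))
      (InnerProductSpace.toDual ℝ E v) D x := by
    have := ((InnerProductSpace.toDual ℝ E v).hasFDerivWithinAt (s := D) (x := x)).add_const
      (φ x - inner ℝ v x)
    refine this.congr (fun z _ => ?_) ?_ <;> simp [inner_sub_right]
    ring
  rw [hasGradientWithinAt_iff_hasFDerivWithinAt]
  have h4 := h2.add h3
  rw [zero_add] at h4
  refine h4.congr (fun z _ => ?_) ?_ <;> simp

/-- Both pairings are the one-sided derivative at `0` along the segment from `x` to `z`, which is
unique. -/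
theorem HasGradientWithinAt.inner_eq {E : Type*} [NormedAddCommGroup E]
    [InnerProductSpace ℝ E] [CompleteSpace E] {φ : E → ℝ} {v v' x z : E} {D : Set E}
    (hD : Convex ℝ D) (hx : x ∈ D) (hz : z ∈ D) (hv : HasGradientWithinAt φ v D x)
    (hv' : HasGradientWithinAt φ v' D x) : (inner ℝ v (z - x) : ℝ) = inner ℝ v' (z - x) := by
  have key : ∀ v, HasGradientWithinAt φ v D x → HasDerivWithinAt
      (fun s : ℝ => φ (x + s • (z - x))) (inner ℝ v (z - x)) (Set.Icc 0 1) 0 := by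
    intro v hv
    have h1 : HasDerivWithinAt (fun s : ℝ => x + s • (z - x)) (z - x) (Set.Icc 0 1) 0 := by
      simpa using (((hasDerivAt_id (0 : ℝ)).smul_const (z - x)).const_add x).hasDerivWithinAt
    have h2 := HasFDerivWithinAt.comp_hasDerivWithinAt_of_eq (y := x) 0 hv.hasFDerivWithinAt h1
      (fun s hs => hD.add_smul_sub_mem hx hz hs) (by simp)
    simpa [Function.comp_def] using h2
  exact (uniqueDiffOn_Icc zero_lt_one 0 (Set.left_mem_Icc.2 zero_le_one)).eq_deriv _
    (key v hv) (key v' hv')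

theorem IsProblem.isGradXP (H : IsProblem f g h L μ Z) (hW : IsMixing G W) {x : Vec n₁}
    (hx : x ∈ dom g) (Λ : Stack m n₂) : IsGradXP f g h W L x Λ (gradPX f h W L x Λ) := by
  refine hasGradientWithinAt_of_quadratic (C := L / 2 + L ^ 2 / μ) hx fun z hz => ?_
  have h1 := H.valP_lower (W := W) hx hz Λ Λ
  have h2 := H.valP_upper hW hx hz Λ Λ
  rw [H.bigP_eq hx, H.bigP_eq hz, EReal.toReal_coe, EReal.toReal_coe]
  simp only [sub_self, inner_zero_right, norm_zero] at h1 h2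
  have hL := H.L_pos
  have hμ := H.mu_pos
  have h3 : 0 ≤ (L ^ 2 / μ) * ‖z - x‖ ^ 2 := by positivity
  rw [abs_le]
  constructor <;> linarith

theorem IsProblem.isGradLP (H : IsProblem f g h L μ Z) (hW : IsMixing G W) {x : Vec n₁}
    (hx : x ∈ dom g) (Λ : Stack m n₂) : IsGradLP f h W L x Λ (gradPL f h W L x Λ) := by
  rw [IsGradLP, ← hasGradientWithinAt_univ]
  refine hasGradientWithinAt_of_quadratic (C := L ^ 2 / μ) (Set.mem_univ _) fun z _ => ?_
  have h1 := H.valP_lower (W := W) hx hx Λ z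
  have h2 := H.valP_upper hW hx hx Λ z
  rw [H.bigP_eq hx, H.bigP_eq hx, EReal.toReal_coe, EReal.toReal_coe]
  simp only [sub_self, inner_zero_right, norm_zero] at h1 h2
  have hL := H.L_pos
  have hμ := H.mu_pos
  have h3 : 0 ≤ (L ^ 2 / μ) * ‖z - Λ‖ ^ 2 := by positivity
  rw [abs_le]
  constructor <;> linarith

end Value

/-! ### Summing the recursions -/

/-- Convexity of the square with weights `ρ` and `1 - ρ` at the points `x` and `y/(1 - ρ)`. -/
theorem weighted_sq_le {ρ x y : ℝ} (h0 : 0 ≤ ρ) (h1 : ρ < 1) :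
    (ρ * x + y) ^ 2 ≤ ρ * x ^ 2 + y ^ 2 / (1 - ρ) := by
  have hγ : 0 < 1 - ρ := sub_pos.2 h1
  have e : ρ * x ^ 2 + y ^ 2 / (1 - ρ) - (ρ * x + y) ^ 2
      = ρ / (1 - ρ) * ((1 - ρ) * x - y) ^ 2 := by
    field_simp; ring
  have : 0 ≤ ρ / (1 - ρ) * ((1 - ρ) * x - y) ^ 2 := by positivity
  linarith

theorem sum_weighted_sq_le {ρ : ℝ} (h0 : 0 ≤ ρ) (h1 : ρ < 1) (x y : ℕ → ℝ) (T : ℕ) :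
    ∑ t ∈ Finset.range T, (ρ * x t + y t) ^ 2
      ≤ ρ * ∑ t ∈ Finset.range T, x t ^ 2 + (∑ t ∈ Finset.range T, y t ^ 2) / (1 - ρ) := by
  rw [Finset.mul_sum, Finset.sum_div, ← Finset.sum_add_distrib]
  exact Finset.sum_le_sum fun t _ => weighted_sq_le h0 h1

theorem sum_succ_sq_le {ρ : ℝ} {x y : ℕ → ℝ} (hx : ∀ t, 0 ≤ x t)
    (hrec : ∀ t, x (t + 1) ≤ ρ * x t + y t) (T : ℕ) :
    ∑ t ∈ Finset.range T, x (t + 1) ^ 2 ≤ ∑ t ∈ Finset.range T, (ρ * x t + y t) ^ 2 :=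
  Finset.sum_le_sum fun t _ => pow_le_pow_left₀ (hx _) (hrec t) 2

theorem sum_sq_le_sum_succ_sq (x : ℕ → ℝ) (T : ℕ) :
    ∑ t ∈ Finset.range T, x t ^ 2 ≤ x 0 ^ 2 + ∑ t ∈ Finset.range T, x (t + 1) ^ 2 := by
  have h1 := Finset.sum_range_succ' (fun t => x t ^ 2) T
  have h2 := Finset.sum_range_succ (fun t => x t ^ 2) T
  have := sq_nonneg (x T)
  linarith

/-- Summed form of a linear recursion with contraction factor `ρ`. -/
theorem sum_sq_le_of_recursion {ρ : ℝ} (h0 : 0 ≤ ρ) (h1 : ρ < 1) {x y : ℕ → ℝ}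
    (hx : ∀ t, 0 ≤ x t) (hrec : ∀ t, x (t + 1) ≤ ρ * x t + y t) (T : ℕ) :
    ∑ t ∈ Finset.range T, x t ^ 2
      ≤ x 0 ^ 2 / (1 - ρ) + (∑ t ∈ Finset.range T, y t ^ 2) / (1 - ρ) ^ 2 := by
  have hγ : 0 < 1 - ρ := sub_pos.2 h1
  have e1 := sum_weighted_sq_le h0 h1 x y T
  have e2 := sum_succ_sq_le hx hrec T
  have e3 := sum_sq_le_sum_succ_sq x T
  have e4 : (1 - ρ) * ∑ t ∈ Finset.range T, x t ^ 2
      ≤ x 0 ^ 2 + (∑ t ∈ Finset.range T, y t ^ 2) / (1 - ρ) := by linarith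
  rw [mul_comm, ← le_div_iff₀ hγ] at e4
  refine e4.trans (le_of_eq ?_)
  field_simp

theorem sum_inv_sq_le (T : ℕ) :
    ∑ t ∈ Finset.range T, 1 / (1 + (t : ℝ)) ^ 2 ≤ 2 := by
  -- The sharper bound makes the induction telescope through `1/(k+2)² ≤ 1/(k+1) - 1/(k+2)`.
  have key : ∀ T : ℕ, ∑ t ∈ Finset.range (T + 1), 1 / (1 + (t : ℝ)) ^ 2
      ≤ 2 - 1 / (1 + (T : ℝ)) := by
    intro T
    induction T with
    | zero => simp; norm_num
    | succ k ih =>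
      rw [Finset.sum_range_succ]
      have h1 : 1 / (1 + ((k + 1 : ℕ) : ℝ)) ^ 2
          ≤ 1 / (1 + (k : ℝ)) - 1 / (1 + ((k + 1 : ℕ) : ℝ)) := by
        push_cast
        rw [div_sub_div _ _ (by positivity) (by positivity),
          div_le_div_iff₀ (by positivity) (by positivity)]
        have hk : (0 : ℝ) ≤ k := Nat.cast_nonneg k
        nlinarith
      linarith
  cases T with
  | zero => simp
  | succ k =>
    have h1 := key k
    have h2 : 0 ≤ 1 / (1 + (k : ℝ)) := by positivity
    linarith

/-- By Cauchy–Schwarz the squared mean is at most the mean of the squares, here at most `C/T ≤ ε²`.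
-/
theorem uniformExp_le {T : ℕ} {z z' : ℕ → ℝ} {C ε : ℝ} (hT : 0 < T) (hε : 0 < ε)
    (hz : ∀ t < T, z t ≤ z' t) (hC : ∑ t ∈ Finset.range T, z' t ^ 2 ≤ C) (hCT : C ≤ T * ε ^ 2) :
    uniformExp T z ≤ ε := by
  have hT' : (0 : ℝ) < T := by exact_mod_cast hT
  have h1 : ∑ t ∈ Finset.range T, z t ≤ ∑ t ∈ Finset.range T, z' t :=
    Finset.sum_le_sum fun t ht => hz t (Finset.mem_range.1 ht)
  have h2 : (∑ t ∈ Finset.range T, z' t) ^ 2 ≤ T * ∑ t ∈ Finset.range T, z' t ^ 2 := by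
    simpa using sq_sum_le_card_mul_sum_sq (s := Finset.range T) (f := z')
  have h3 : ∑ t ∈ Finset.range T, z' t ≤ T * ε := by
    refine le_of_sq_le_sq ?_ (by positivity)
    calc (∑ t ∈ Finset.range T, z' t) ^ 2 ≤ T * ∑ t ∈ Finset.range T, z' t ^ 2 := h2
      _ ≤ T * (T * ε ^ 2) := by gcongr; exact hC.trans hCT
      _ = (T * ε) ^ 2 := by ring
  rw [uniformExp, one_div, inv_mul_le_iff₀ hT']
  linarith

/-! ### The stepsizes -/

section Steps

variable {ρ L κ : ℝ}

theorem stepX_pos (h1 : ρ < 1) (hL : 0 < L) : 0 < stepX ρ L κ := by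
  have hγ : 0 < 1 - ρ := sub_pos.2 h1
  unfold stepX
  positivity

theorem stepL_pos (h1 : ρ < 1) (hL : 0 < L) (hκ : 1 ≤ κ) : 0 < stepL ρ L κ := by
  have hγ : 0 < 1 - ρ := sub_pos.2 h1
  unfold stepL
  positivity

theorem stepX_sq (hL : 0 < L) :
    stepX ρ L κ ^ 2 * (L ^ 2 * (1 + 6 * κ ^ 2)) = (1 - ρ) ^ 4 / 25 := by
  have h : √(1 + 6 * κ ^ 2) ^ 2 = 1 + 6 * κ ^ 2 := Real.sq_sqrt (by positivity)
  unfold stepX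
  rw [div_pow, mul_pow, h]
  field_simp
  norm_num

/-- For `κ ≥ 1` one has `(1 + 3κ²)/(1 + 6κ²) ≤ 4/7`, and `4/7 · 1/25 = 4/175`. -/
theorem stepX_sq_mul_le (hL : 0 < L) (hκ : 1 ≤ κ) :
    stepX ρ L κ ^ 2 * (L ^ 2 * (1 + 3 * κ ^ 2)) ≤ 4 / 175 * (1 - ρ) ^ 4 := by
  have h := stepX_sq (ρ := ρ) (κ := κ) hL
  have h2 : 0 ≤ stepX ρ L κ ^ 2 * L ^ 2 := by positivity
  nlinarith [mul_nonneg h2 (show 0 ≤ κ ^ 2 - 1 by nlinarith)]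

theorem stepX_sq_mul_sq_le (hL : 0 < L) :
    stepX ρ L κ ^ 2 * (L * κ) ^ 2 ≤ (1 - ρ) ^ 4 / 150 := by
  have h := stepX_sq (ρ := ρ) (κ := κ) hL
  have h2 : 0 ≤ stepX ρ L κ ^ 2 * L ^ 2 := by positivity
  nlinarith

theorem mul_stepX_le (hL : 0 < L) : L * κ * stepX ρ L κ ≤ (1 - ρ) ^ 2 / 12 := by
  refine le_of_sq_le_sq ?_ (by positivity)
  have h := stepX_sq_mul_sq_le (ρ := ρ) (κ := κ) hL
  have : 0 ≤ (1 - ρ) ^ 4 := by positivity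
  calc (L * κ * stepX ρ L κ) ^ 2 = stepX ρ L κ ^ 2 * (L * κ) ^ 2 := by ring
    _ ≤ (1 - ρ) ^ 4 / 144 := by linarith
    _ = ((1 - ρ) ^ 2 / 12) ^ 2 := by ring

/-- `1 + 6κ² ≤ 7κ²` and `25 · 7 ≤ 14²`: the stepsize is not too small, so that bounds on steps
convert into bounds on gradients. -/
theorem le_mul_stepX (h1 : ρ < 1) (hL : 0 < L) (hκ : 1 ≤ κ) :
    (1 - ρ) ^ 2 ≤ 14 * (L * κ) * stepX ρ L κ := by
  have hη := stepX_pos (κ := κ) h1 hL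
  refine le_of_sq_le_sq ?_ (by positivity)
  have h := stepX_sq (ρ := ρ) (κ := κ) hL
  have h2 : 0 ≤ stepX ρ L κ ^ 2 * L ^ 2 := by positivity
  nlinarith [mul_nonneg h2 (show 0 ≤ κ ^ 2 - 1 by nlinarith)]

theorem mul_stepL_le (hL : 0 < L) (hκ : 1 ≤ κ) :
    9 * (L * κ) * stepL ρ L κ ≤ (1 - ρ) ^ 2 := by
  unfold stepL
  rw [mul_div_assoc', div_le_iff₀ (by positivity)]
  nlinarith [mul_nonneg hL.le (sq_nonneg (1 - ρ))]

theorem le_mul_stepL (hL : 0 < L) (hκ : 1 ≤ κ) :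
    (1 - ρ) ^ 2 ≤ 11 * (L * κ) * stepL ρ L κ := by
  unfold stepL
  rw [mul_div_assoc', le_div_iff₀ (by positivity)]
  nlinarith [mul_nonneg (mul_nonneg hL.le (sq_nonneg (1 - ρ))) (sub_nonneg.2 hκ)]

end Steps

/-! ### Scalar form of the analysis: descent, summation and stationarity. -/

theorem step_le {L K η ηl a b u D r p p' : ℝ} (hη : 0 < η) (hl : 0 < ηl) (hKη : K * η ≤ 1 / 12)
    (hKl : K * ηl ≤ 1 / 9) (hLK : L ≤ K) (ha : 0 ≤ a) (hu : 0 ≤ u)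
    (hK : 0 ≤ K)
    (hd : p' ≤ p - a ^ 2 / η - b ^ 2 / ηl + (L / 2 + K) * a ^ 2 + K * b ^ 2
      + (L * u + (K * u + D)) * a + (K * u + D) * b + r ^ 2 / (4 * η)) :
    p' - p ≤ -(2 / 3) * (η⁻¹ * a ^ 2) - 17 / 24 * (ηl⁻¹ * b ^ 2) + 1 / 8 * (η⁻¹ * u ^ 2)
      + 2 * ((η + ηl) * D ^ 2) + 1 / 4 * (η⁻¹ * r ^ 2) := by
  have kη : K ≤ 1 / 12 * η⁻¹ := by rw [← div_eq_mul_inv, le_div_iff₀ hη]; exact hKη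
  have kl : K ≤ 1 / 9 * ηl⁻¹ := by rw [← div_eq_mul_inv, le_div_iff₀ hl]; exact hKl
  have q1 : ∀ {θ c : ℝ}, 0 < θ → D * c ≤ 2 * (θ * D ^ 2) + 1 / 8 * (θ⁻¹ * c ^ 2) := by
    intro θ c hθ
    have h1 : 0 ≤ 2 * θ * (D - c / (4 * θ)) ^ 2 := by positivity
    have h2 : 2 * θ * (D - c / (4 * θ)) ^ 2
      = 2 * (θ * D ^ 2) + 1 / 8 * (θ⁻¹ * c ^ 2) - D * c := by field_simp; ring
    linarith only [h1, h2]
  have q2 : L * (u * a) ≤ K * (u * a) := mul_le_mul_of_nonneg_right hLK (by positivity)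
  have q3 : 0 ≤ K * (u - a) ^ 2 := by positivity
  have q4 : 0 ≤ K * (u - b) ^ 2 := by positivity
  have m1 := mul_le_mul_of_nonneg_right kη (sq_nonneg a)
  have m2 := mul_le_mul_of_nonneg_right kl (sq_nonneg b)
  have m3 := mul_le_mul_of_nonneg_right kη (sq_nonneg u)
  have m4 := mul_le_mul_of_nonneg_right hLK (sq_nonneg a)
  have r1 : a ^ 2 / η = η⁻¹ * a ^ 2 := by ring
  have r2 : b ^ 2 / ηl = ηl⁻¹ * b ^ 2 := by ring
  have r3 : r ^ 2 / (4 * η) = 1 / 4 * (η⁻¹ * r ^ 2) := by field_simp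
  rw [r1, r2, r3] at hd
  have s1 := q1 (c := a) hη
  have s2 := q1 (c := b) hl
  -- The cross terms are split as `2Kua ≤ K(u² + a²)`, `Kub ≤ K(u² + b²)/2` and `Dc ≤ 2θD² +
  -- c²/(8θ)`. The coefficients become `-1 + 5/24 + 1/8 = -2/3` for `a²/η`, `-1 + 1/6 + 1/8 =
  -- -17/24` for `b²/ηl` and `3/2 · 1/12 = 1/8` for `u²/η`.
  linarith only [hd, q2, q3, q4, m1, m2, m3, m4, s1, s2]

/-- The scalar relations between the quantities of a run: `a`, `b` are the lengths of the averaged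
primal and of the dual steps, `u`, `s` the consensus errors of the iterates and of the tracked
gradients, `q` the change of the local gradients, `D` the scaled tolerances and `φ` the values of
the objective. -/
structure IsScalarRun (ρ L κ η ηl φstar : ℝ) (a b u s q D φ : ℕ → ℝ) : Prop where
  a_nonneg : ∀ t, 0 ≤ a t
  u_nonneg : ∀ t, 0 ≤ u t
  s_nonneg : ∀ t, 0 ≤ s t
  D_nonneg : ∀ t, 0 ≤ D t
  D_le : ∀ t : ℕ, D t ≤ (1 - ρ) ^ 2 / (8 * (1 + (t : ℝ)))
  u_zero : u 0 = 0
  u_succ : ∀ t, u (t + 1) ≤ ρ * u t + η * s t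
  s_zero : s 0 ^ 2 ≤ 2 * (L * κ) * (1 - ρ)
  s_succ : ∀ t, s (t + 1) ≤ ρ * s t + q t
  q_sq : ∀ t, q t ^ 2 ≤ L ^ 2 * (1 + 3 * κ ^ 2) * (a t ^ 2 + 2 * u t ^ 2 + 2 * u (t + 1) ^ 2)
    + 3 * (L * κ) ^ 2 * b t ^ 2 + 6 * (D t ^ 2 + D (t + 1) ^ 2)
  descent : ∀ t, φ (t + 1) ≤ φ t - a t ^ 2 / η - b t ^ 2 / ηl + (L / 2 + L * κ) * a t ^ 2
    + L * κ * b t ^ 2 + (L * u t + (L * κ * u t + D t)) * a t + (L * κ * u t + D t) * b t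
    + (ρ * u t + η * s t) ^ 2 / (4 * η)
  lower : ∀ t, φstar ≤ φ t

namespace IsScalarRun

variable {ρ L κ φstar : ℝ} {a b u s q D φ : ℕ → ℝ}

theorem sum_D_sq {η ηl : ℝ} (hr : IsScalarRun ρ L κ η ηl φstar a b u s q D φ) (T : ℕ) :
    ∑ t ∈ Finset.range T, D t ^ 2 ≤ (1 - ρ) ^ 4 / 32 ∧
      ∑ t ∈ Finset.range T, D (t + 1) ^ 2 ≤ (1 - ρ) ^ 4 / 32 := by
  have h2 : ∑ t ∈ Finset.range T, (1 - ρ) ^ 4 / 64 * (1 / (1 + (t : ℝ)) ^ 2)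
      ≤ (1 - ρ) ^ 4 / 32 := by
    rw [← Finset.mul_sum]
    have := mul_le_mul_of_nonneg_left (sum_inv_sq_le T) (show 0 ≤ (1 - ρ) ^ 4 / 64 by positivity)
    linarith
  have e : ∀ t : ℕ, ((1 - ρ) ^ 2 / (8 * (1 + (t : ℝ)))) ^ 2
      = (1 - ρ) ^ 4 / 64 * (1 / (1 + (t : ℝ)) ^ 2) := by
    intro t
    have : (1 + (t : ℝ)) ≠ 0 := by positivity
    field_simp
    norm_num
  constructor <;> refine (Finset.sum_le_sum fun t _ => ?_).trans h2
  · rw [← e]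
    exact pow_le_pow_left₀ (hr.D_nonneg t) (hr.D_le t) 2
  · rw [← e]
    refine pow_le_pow_left₀ (hr.D_nonneg _) ((hr.D_le (t + 1)).trans ?_) 2
    push_cast
    gcongr
    linarith

variable (h0 : 0 ≤ ρ) (h1 : ρ < 1) (hL : 0 < L) (hκ : 1 ≤ κ)
include h0 h1

/-- As `u 0 = 0`, no initial term appears. If `N` denotes the common bound, the weights give `ρN +
(1 - ρ)N = N`, so the intermediate quantity `ρu + ηs`, and with it the shifted sequence, obeys the
same bound. -/
theorem sum_u {η ηl : ℝ} (hr : IsScalarRun ρ L κ η ηl φstar a b u s q D φ) (T : ℕ) :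
    ∑ t ∈ Finset.range T, u t ^ 2 ≤ η ^ 2 * (∑ t ∈ Finset.range T, s t ^ 2) / (1 - ρ) ^ 2 ∧
    ∑ t ∈ Finset.range T, (ρ * u t + η * s t) ^ 2
      ≤ η ^ 2 * (∑ t ∈ Finset.range T, s t ^ 2) / (1 - ρ) ^ 2 ∧
    ∑ t ∈ Finset.range T, u (t + 1) ^ 2
      ≤ η ^ 2 * (∑ t ∈ Finset.range T, s t ^ 2) / (1 - ρ) ^ 2 := by
  have hγ : 0 < 1 - ρ := sub_pos.2 h1
  have e1 := sum_sq_le_of_recursion h0 h1 hr.u_nonneg hr.u_succ T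
  have e2 := sum_weighted_sq_le h0 h1 u (fun t => η * s t) T
  have e3 := sum_succ_sq_le hr.u_nonneg hr.u_succ T
  simp only [mul_pow, ← Finset.mul_sum, hr.u_zero] at e1 e2
  norm_num at e1
  have e4 : ρ * (η ^ 2 * (∑ t ∈ Finset.range T, s t ^ 2) / (1 - ρ) ^ 2)
      + η ^ 2 * (∑ t ∈ Finset.range T, s t ^ 2) / (1 - ρ)
      = η ^ 2 * (∑ t ∈ Finset.range T, s t ^ 2) / (1 - ρ) ^ 2 := by
    field_simp; ring
  have e5 := mul_le_mul_of_nonneg_left e1 h0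
  refine ⟨e1, ?_, ?_⟩ <;> linarith

include hL hκ

/-- Bounds on the accumulated steps and consensus errors. -/
theorem sum_bounds (hr : IsScalarRun ρ L κ (stepX ρ L κ) (stepL ρ L κ) φstar a b u s q D φ)
    (T : ℕ) : ∃ N : ℝ, 0 ≤ N ∧ ∑ t ∈ Finset.range T, u t ^ 2 ≤ N ∧
      ∑ t ∈ Finset.range T, (ρ * u t + stepX ρ L κ * s t) ^ 2 ≤ N ∧
      (∑ t ∈ Finset.range T, a t ^ 2) / stepX ρ L κ ^ 2
        ≤ 3 * (10 * (L * κ * (φ 0 - φstar + 1)) + 1) / (1 - ρ) ^ 2 ∧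
      (∑ t ∈ Finset.range T, b t ^ 2) / stepL ρ L κ ^ 2
        ≤ 3 * (10 * (L * κ * (φ 0 - φstar + 1)) + 1) / (1 - ρ) ^ 2 ∧
      N / stepX ρ L κ ^ 2 ≤ (10 * (L * κ * (φ 0 - φstar + 1)) + 1) / (1 - ρ) ^ 2 := by
  have hγ : 0 < 1 - ρ := sub_pos.2 h1
  have hγ1 : (1 - ρ) ^ 2 ≤ 1 := pow_le_one₀ hγ.le (by linarith)
  obtain ⟨hU, hR, hU1⟩ := hr.sum_u h0 h1 T
  obtain ⟨hD1, hD2⟩ := hr.sum_D_sq T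
  have hS := sum_sq_le_of_recursion h0 h1 hr.s_nonneg hr.s_succ T
  have hη := stepX_pos (κ := κ) h1 hL
  have hl := stepL_pos (κ := κ) h1 hL hκ
  have f1 := stepX_sq_mul_le (ρ := ρ) hL hκ
  have f2 := stepX_sq_mul_sq_le (ρ := ρ) (κ := κ) hL
  have f3 := mul_stepX_le (ρ := ρ) (κ := κ) hL
  have f4 := le_mul_stepX h1 hL hκ
  have f5 := mul_stepL_le (ρ := ρ) hL hκ
  have f6 := le_mul_stepL (ρ := ρ) hL hκ
  have hgap : 0 ≤ φ 0 - φstar := sub_nonneg.2 (hr.lower 0)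
  have hK : 0 < L * κ := by positivity
  have hLK : L ≤ L * κ := le_mul_of_one_le_right hL.le hκ
  have hdesc := hr.descent
  have hq := hr.q_sq
  have hs0 := hr.s_zero
  have hlow := hr.lower T
  generalize stepX ρ L κ = η at *
  generalize stepL ρ L κ = ηl at *
  set K := L * κ with hKdef
  set N := η ^ 2 * (∑ t ∈ Finset.range T, s t ^ 2) / (1 - ρ) ^ 2 with hN
  set A := ∑ t ∈ Finset.range T, a t ^ 2 with hA
  set B := ∑ t ∈ Finset.range T, b t ^ 2 with hB
  set γ := 1 - ρ with hγdef
  have hA0 : 0 ≤ A := Finset.sum_nonneg fun _ _ => sq_nonneg _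
  have hB0 : 0 ≤ B := Finset.sum_nonneg fun _ _ => sq_nonneg _
  have hS0 : 0 ≤ ∑ t ∈ Finset.range T, s t ^ 2 := Finset.sum_nonneg fun _ _ => sq_nonneg _
  have hN0 : 0 ≤ N := by positivity
  -- the tracking error
  have hQ : ∑ t ∈ Finset.range T, q t ^ 2 ≤ L ^ 2 * (1 + 3 * κ ^ 2) * (A + 4 * N)
      + 3 * K ^ 2 * B + 3 / 8 * γ ^ 4 := by
    have e1 := Finset.sum_le_sum fun t (_ : t ∈ Finset.range T) => hq t
    simp only [Finset.sum_add_distrib, ← Finset.mul_sum] at e1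
    refine e1.trans ?_
    have e2 : 0 ≤ L ^ 2 * (1 + 3 * κ ^ 2) := by positivity
    have e3 : A + 2 * ∑ t ∈ Finset.range T, u t ^ 2 + 2 * ∑ t ∈ Finset.range T, u (t + 1) ^ 2
      ≤ A + 4 * N := by linarith
    have e4 := mul_le_mul_of_nonneg_left e3 e2
    linarith
  -- The loop from consensus error to tracking error and back: `N` returns on the right with total
  -- coefficient `16/175`, which the stepsize has made less than one.
  have hNle : N ≤ η ^ 2 / γ ^ 2 * (2 * K) + 4 / 175 * (A + 4 * N) + B / 50 + 3 / 8 * η ^ 2 := by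
    have e1 : s 0 ^ 2 / γ ≤ 2 * K := by rw [div_le_iff₀ hγ]; linarith
    have e2 : N ≤ η ^ 2 / γ ^ 2 * (2 * K) + (η ^ 2 * ∑ t ∈ Finset.range T, q t ^ 2) / γ ^ 4 := by
      have e3 := mul_le_mul_of_nonneg_left hS (show 0 ≤ η ^ 2 / γ ^ 2 by positivity)
      have e4 := mul_le_mul_of_nonneg_left e1 (show 0 ≤ η ^ 2 / γ ^ 2 by positivity)
      have e5 : N = η ^ 2 / γ ^ 2 * ∑ t ∈ Finset.range T, s t ^ 2 := by rw [hN]; ring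
      have e6 : η ^ 2 / γ ^ 2 * ((∑ t ∈ Finset.range T, q t ^ 2) / γ ^ 2)
        = (η ^ 2 * ∑ t ∈ Finset.range T, q t ^ 2) / γ ^ 4 := by field_simp
      rw [mul_add] at e3
      linarith
    have e7 : (η ^ 2 * ∑ t ∈ Finset.range T, q t ^ 2) / γ ^ 4
        ≤ 4 / 175 * (A + 4 * N) + B / 50 + 3 / 8 * η ^ 2 := by
      rw [div_le_iff₀ (by positivity)]
      have g1 := mul_le_mul_of_nonneg_left hQ (sq_nonneg η)
      have g2 := mul_le_mul_of_nonneg_right f1 (show 0 ≤ A + 4 * N by positivity)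
      have g3 := mul_le_mul_of_nonneg_right f2 hB0
      linarith
    linarith
  have hγ2 : 0 < γ ^ 2 := by positivity
  have hKη : K * η ≤ 1 / 12 := by linarith
  have hKl : K * ηl ≤ 1 / 9 := by linarith
  -- The term in `N` is absorbed on the left. The dual steps are converted from `η` to `ηl` by `9Kηl
  -- ≤ γ² ≤ 14Kη`.
  have hNη : N / η ≤ 1 / 5 + 27 / 1000 * (A / η) + 4 / 100 * (B / ηl) + 1 / 2 * η := by
    have e1 : η ^ 2 / γ ^ 2 * (2 * K) ≤ η / 6 := by
      rw [div_mul_eq_mul_div, div_le_iff₀ hγ2]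
      have := mul_le_mul_of_nonneg_left f3 hη.le
      linarith
    have e2 : B / η ≤ 14 / 9 * (B / ηl) := by
      have : 9 * ηl ≤ 14 * η := by
        have : K * (9 * ηl) ≤ K * (14 * η) := by linarith
        exact le_of_mul_le_mul_left this hK
      rw [div_le_iff₀ hη, mul_div_assoc', div_mul_eq_mul_div, le_div_iff₀ hl]
      have := mul_le_mul_of_nonneg_left this hB0
      linarith
    have e3 : N * (159 / 175) ≤ η / 6 + 4 / 175 * A + B / 50 + 3 / 8 * η ^ 2 := by linarith
    have e4 := div_le_div_of_nonneg_right e3 hη.le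
    have e5 : (η / 6 + 4 / 175 * A + B / 50 + 3 / 8 * η ^ 2) / η
      = 1 / 6 + 4 / 175 * (A / η) + 1 / 50 * (B / η) + 3 / 8 * η := by field_simp
    rw [e5, mul_div_right_comm] at e4
    have e6 : 0 ≤ A / η := by positivity
    have e7 : 0 ≤ B / ηl := by positivity
    linarith
  have hdsum : 2 / 3 * (A / η) + 17 / 24 * (B / ηl)
      ≤ φ 0 - φstar + 3 / 8 * (N / η) + (η + ηl) / 16 := by
    have hstep := fun t => step_le hη hl hKη hKl hLK (hr.a_nonneg t) (hr.u_nonneg t)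
      hK.le (hdesc t)
    have e1 := Finset.sum_le_sum fun t (_ : t ∈ Finset.range T) => hstep t
    rw [Finset.sum_range_sub] at e1
    simp only [Finset.sum_add_distrib, Finset.sum_sub_distrib, ← Finset.mul_sum] at e1
    rw [← hA, ← hB] at e1
    have hi : 0 < η⁻¹ := inv_pos.2 hη
    have e2 := mul_le_mul_of_nonneg_left hU hi.le
    have e3 := mul_le_mul_of_nonneg_left hR hi.le
    have e4 : γ ^ 4 / 32 ≤ 1 / 32 := by
      have : γ ^ 4 = γ ^ 2 * γ ^ 2 := by ring
      nlinarith only [this, hγ1, hγ2]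
    have e5 := mul_le_mul_of_nonneg_left (hD1.trans e4) (add_pos hη hl).le
    rw [div_eq_mul_inv A, div_eq_mul_inv B, div_eq_mul_inv N]
    linarith only [e1, e2, e3, e5, hlow]
  set M := K * (φ 0 - φstar + 1) with hM
  have hKM : K ≤ M := le_mul_of_one_le_right hK.le (by linarith)
  set x := A / η with hx
  set y := B / ηl with hy
  have hx0 : 0 ≤ x := by positivity
  have hy0 : 0 ≤ y := by positivity
  -- After `hNη` is inserted into `hdsum`, both `x` and `y` keep a coefficient of at least `5/8`.
  have hxy : x ≤ 8 / 5 * (φ 0 - φstar + 1 / 10 + 3 / 10 * η + 1 / 10 * ηl) := by linarith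
  have hyx : y ≤ 8 / 5 * (φ 0 - φstar + 1 / 10 + 3 / 10 * η + 1 / 10 * ηl) := by linarith
  have hKx : K * x ≤ 8 / 5 * (M + 1 / 20) := by
    have := mul_le_mul_of_nonneg_left hxy hK.le
    linarith
  have hKy : K * y ≤ 8 / 5 * (M + 1 / 20) := by
    have := mul_le_mul_of_nonneg_left hyx hK.le
    linarith
  refine ⟨N, hN0, hU, hR, ?_, ?_, ?_⟩
  · have e : A / η ^ 2 = x / η := by rw [hx]; field_simp
    rw [e, div_le_div_iff₀ hη hγ2]
    have g1 := mul_le_mul_of_nonneg_left f4 hx0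
    have g2 := mul_le_mul_of_nonneg_right hKx hη.le
    have g3 : 0 ≤ M * η := by positivity
    linarith
  · have e : B / ηl ^ 2 = y / ηl := by rw [hy]; field_simp
    rw [e, div_le_div_iff₀ hl hγ2]
    have g1 := mul_le_mul_of_nonneg_left f6 hy0
    have g2 := mul_le_mul_of_nonneg_right hKy hl.le
    have g3 : 0 ≤ M * ηl := by positivity
    linarith
  · have e : N / η ^ 2 = N / η / η := by field_simp
    rw [e, div_le_div_iff₀ hη hγ2]
    have g0 : 0 ≤ N / η := by positivity
    have g1 := mul_le_mul_of_nonneg_left f4 g0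
    have g2 := mul_le_mul_of_nonneg_left hNη hK.le
    have g3 : K * (N / η) ≤ 1 / 2 * M + 1 / 15 := by linarith
    have g4 := mul_le_mul_of_nonneg_right g3 hη.le
    have g5 : 0 ≤ M * η := by positivity
    linarith

/-- In units of `M = (10Lκ(φ 0 - φstar + 1) + 1)/(1 - ρ)²`, the scaled steps contribute at most `3M`
each, the consensus terms at most `M` and `M/10`, and the tolerances at most `M`. With the weights
from splitting the squares, every total stays below `64M`. -/
theorem stationarity_bounds
    (hr : IsScalarRun ρ L κ (stepX ρ L κ) (stepL ρ L κ) φstar a b u s q D φ) (T : ℕ) :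
    ∑ t ∈ Finset.range T, (a t / stepX ρ L κ + (ρ * u t + stepX ρ L κ * s t) / stepX ρ L κ
      + (L * u t + (L * κ * u t + D t))) ^ 2
      ≤ 64 * (10 * L * κ * (φ 0 - φstar + 1) + 1) / (1 - ρ) ^ 2 ∧
    ∑ t ∈ Finset.range T, (L * u t) ^ 2
      ≤ 64 * (10 * L * κ * (φ 0 - φstar + 1) + 1) / (1 - ρ) ^ 2 ∧
    ∑ t ∈ Finset.range T, (b t / stepL ρ L κ + (L * κ * u t + D t)) ^ 2
      ≤ 64 * (10 * L * κ * (φ 0 - φstar + 1) + 1) / (1 - ρ) ^ 2 := by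
  have hγ : 0 < 1 - ρ := sub_pos.2 h1
  have hγ1 : (1 - ρ) ^ 2 ≤ 1 := pow_le_one₀ hγ.le (by linarith)
  have hγ2 : 0 < (1 - ρ) ^ 2 := by positivity
  obtain ⟨N, hN0, hU, hR, hA, hB, hN⟩ := hr.sum_bounds h0 h1 hL hκ T
  obtain ⟨hD1, -⟩ := hr.sum_D_sq T
  have hη := stepX_pos (κ := κ) h1 hL
  have hl := stepL_pos (κ := κ) h1 hL hκ
  have f3 := mul_stepX_le (ρ := ρ) (κ := κ) hL
  have hgap : 0 ≤ φ 0 - φstar := sub_nonneg.2 (hr.lower 0)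
  have hK : 0 < L * κ := by positivity
  have hLK : L ≤ L * κ := le_mul_of_one_le_right hL.le hκ
  have hu := hr.u_nonneg
  have hD := hr.D_nonneg
  rw [mul_assoc 10 L κ, mul_assoc 10 (L * κ)]
  generalize stepX ρ L κ = η at *
  generalize stepL ρ L κ = ηl at *
  set K := L * κ with hKdef
  have hM' : 0 ≤ K * (φ 0 - φstar + 1) := by positivity
  set M := (10 * (K * (φ 0 - φstar + 1)) + 1) / (1 - ρ) ^ 2 with hM
  have hM1 : 1 ≤ M := by
    rw [hM, le_div_iff₀ hγ2]
    linarith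
  rw [mul_div_assoc, ← hM] at hA hB ⊢
  have hKN : K ^ 2 * N ≤ M / 10 := by
    have e1 : K ≤ 1 / 12 / η := by rw [le_div_iff₀ hη]; linarith
    have e2 : K ^ 2 ≤ 1 / 144 / η ^ 2 := by
      have := pow_le_pow_left₀ hK.le e1 2
      rw [div_pow] at this
      norm_num at this ⊢
      exact this
    have e3 := mul_le_mul_of_nonneg_right e2 hN0
    have e4 : 1 / 144 / η ^ 2 * N = 1 / 144 * (N / η ^ 2) := by ring
    linarith
  have hDs : ∑ t ∈ Finset.range T, D t ^ 2 ≤ M := by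
    have e4 : (1 - ρ) ^ 4 / 32 ≤ 1 := by
      have : (1 - ρ) ^ 4 = (1 - ρ) ^ 2 * (1 - ρ) ^ 2 := by ring
      nlinarith only [this, hγ1, hγ2]
    linarith
  have hKU := mul_le_mul_of_nonneg_left hU (sq_nonneg K)
  have three : ∀ x y z : ℝ, (x + y + z) ^ 2 ≤ 3 * x ^ 2 + 3 * y ^ 2 + 3 * z ^ 2 := by
    intro x y z
    nlinarith only [sq_nonneg (x - y), sq_nonneg (x - z), sq_nonneg (y - z)]
  refine ⟨?_, ?_, ?_⟩
  · have e : ∀ t ∈ Finset.range T, (a t / η + (ρ * u t + η * s t) / η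
        + (L * u t + (K * u t + D t))) ^ 2
        ≤ 3 * (a t ^ 2 / η ^ 2) + 3 * ((ρ * u t + η * s t) ^ 2 / η ^ 2)
          + (24 * (K ^ 2 * u t ^ 2) + 6 * D t ^ 2) := by
      intro t _
      have g1 := three (a t / η) ((ρ * u t + η * s t) / η) (L * u t + (K * u t + D t))
      have g2 : (L * u t + (K * u t + D t)) ^ 2 ≤ (2 * (K * u t) + D t) ^ 2 := by
        have hu' := hu t
        have hD' := hD t
        refine pow_le_pow_left₀ (by positivity) ?_ 2
        have := mul_le_mul_of_nonneg_right hLK hu'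
        linarith
      rw [div_pow, div_pow] at g1
      nlinarith only [g1, g2, sq_nonneg (2 * (K * u t) - D t)]
    refine (Finset.sum_le_sum e).trans ?_
    simp only [Finset.sum_add_distrib, ← Finset.mul_sum, ← Finset.sum_div]
    have hR' := div_le_div_of_nonneg_right hR (sq_nonneg η)
    linarith
  · simp only [mul_pow, ← Finset.mul_sum]
    have h3 : L ^ 2 * ∑ t ∈ Finset.range T, u t ^ 2 ≤ K ^ 2 * ∑ t ∈ Finset.range T, u t ^ 2 := by
      gcongr
    linarith
  · have e : ∀ t ∈ Finset.range T, (b t / ηl + (K * u t + D t)) ^ 2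
        ≤ 3 * (b t ^ 2 / ηl ^ 2) + 3 * (K ^ 2 * u t ^ 2) + 3 * D t ^ 2 := by
      intro t _
      have g1 := three (b t / ηl) (K * u t) (D t)
      rw [div_pow, mul_pow] at g1
      rwa [← add_assoc]
    refine (Finset.sum_le_sum e).trans ?_
    simp only [Finset.sum_add_distrib, ← Finset.mul_sum, ← Finset.sum_div]
    linarith

end IsScalarRun

/-! ### Properties of a run -/

/-- The stack of the partial gradients `∇ₓ fᵢ(xᵢ, yᵢ)`. -/
def gradStack {m n₁ n₂ : ℕ} (f : Fin m → PairVec n₁ n₂ → ℝ) (X : Stack m n₁) (Y : Stack m n₂) :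
    Stack m n₁ := WithLp.toLp 2 fun i => gradX (f i) (X i) (Y i)

section Run

variable {m n₁ n₂ : ℕ} {f : Fin m → PairVec n₁ n₂ → ℝ} {g : Vec n₁ → EReal} {h : Vec n₂ → EReal}
  {L μ : ℝ} {Z : Set (PairVec n₁ n₂)} {G : SimpleGraph (Fin m)} {W : Matrix (Fin m) (Fin m) ℝ}
  {x0 : Vec n₁} {ηx ηl : ℝ} {δ : ℕ → ℝ} {X V : ℕ → Stack m n₁} {Λ Y : ℕ → Stack m n₂}

@[simp] theorem gradStack_apply (X : Stack m n₁) (Y : Stack m n₂) (i : Fin m) :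
    gradStack f X Y i = gradX (f i) (X i) (Y i) := rfl

theorem IsProblem.norm_sq_gradStack_sub_le (H : IsProblem f g h L μ Z) {X X' : Stack m n₁}
    {Y Y' : Stack m n₂} (hX : ∀ i, X i ∈ dom g) (hX' : ∀ i, X' i ∈ dom g)
    (hY : ∀ i, Y i ∈ dom h) (hY' : ∀ i, Y' i ∈ dom h) :
    ‖gradStack f X Y - gradStack f X' Y'‖ ^ 2 ≤ L ^ 2 * (‖X - X'‖ ^ 2 + ‖Y - Y'‖ ^ 2) := by
  simp only [norm_sq_stack]
  rw [← Finset.sum_add_distrib, Finset.mul_sum]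
  exact Finset.sum_le_sum fun i _ => (H.smooth i).norm_sq_gradX_sub_le
    (H.mem _ (hX i) _ (hY i)) (H.mem _ (hX' i) _ (hY' i))

theorem IsProblem.norm_gradStack_sub_le (H : IsProblem f g h L μ Z) {X X' : Stack m n₁}
    {Y Y' : Stack m n₂} (hX : ∀ i, X i ∈ dom g) (hX' : ∀ i, X' i ∈ dom g)
    (hY : ∀ i, Y i ∈ dom h) (hY' : ∀ i, Y' i ∈ dom h) :
    ‖gradStack f X Y - gradStack f X' Y'‖ ≤ L * (‖X - X'‖ + ‖Y - Y'‖) := by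
  have hL := H.L_pos
  refine le_of_sq_le_sq ((H.norm_sq_gradStack_sub_le hX hX' hY hY').trans ?_) (by positivity)
  rw [mul_pow]
  gcongr
  nlinarith [mul_nonneg (norm_nonneg (X - X')) (norm_nonneg (Y - Y'))]

theorem IsMixing.norm_perp_sub_smul_le (hW : IsMixing G W) (hm : 0 < m) (hη : 0 < ηx)
    (A B : Stack m n₁) :
    ‖perp (matMul W A - ηx • B)‖ ≤ rho W * ‖perp A‖ + ηx * ‖perp B‖ := by
  rw [perp_sub, perp_smul]
  refine (norm_sub_le _ _).trans ?_
  rw [norm_smul, Real.norm_eq_abs, abs_of_pos hη]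
  have := hW.norm_perp_matMul_le hm A
  linarith

namespace IsRun

variable (H : IsProblem f g h L μ Z) (hW : IsMixing G W)
  (hrun : IsRun f g h W L x0 ηx ηl δ X Λ Y V) (hx0 : x0 ∈ dom g) (hη : 0 < ηx)
  (hδ : ∀ t, 0 ≤ δ t)

include hrun

theorem x_succ (t : ℕ) (i : Fin m) :
    X (t + 1) i = prox (scale ηx g) ((matMul W (X t) - ηx • V t) i) := hrun.x_step t i

theorem v_succ (t : ℕ) : V (t + 1)
    = matMul W (V t) + (gradStack f (X (t + 1)) (Y (t + 1)) - gradStack f (X t) (Y t)) := by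
  ext1 i
  rw [hrun.v_step t i]
  simp only [PiLp.add_apply, PiLp.sub_apply, matMul_apply, gradStack_apply]
  abel

theorem l_succ_sub (t : ℕ) : Λ (t + 1) - Λ t
    = (L * ηl / (2 * √(m : ℝ))) • matMul (W - 1) (Y t) := by
  ext1 i
  rw [PiLp.sub_apply, PiLp.smul_apply, matMul_sub_one_apply, hrun.l_step t i, add_sub_cancel_left]

include hW in
-- The invariant of gradient tracking: mixing preserves averages, and the added gradient differences
-- telescope from the initialization.
theorem avg_v (t : ℕ) : avg (V t) = avg (gradStack f (X t) (Y t)) := by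
  induction t with
  | zero =>
    congr 1
    ext1 i
    exact hrun.v_init i
  | succ t ih =>
    rw [hrun.v_succ, avg_add, avg_sub, hW.avg_matMul, ih]
    abel

include H hx0 hη

theorem x_mem (t : ℕ) (i : Fin m) : X t i ∈ dom g := by
  cases t with
  | zero => rw [hrun.x_init]; exact hx0
  | succ t =>
    rw [hrun.x_succ]
    exact (prox_scale_spec H.closed_g ⟨x0, hx0⟩ hη _).1

theorem avg_mem (t : ℕ) : avg (X t) ∈ dom g :=
  (H.closed_g.jensen H.pos _ (hrun.x_mem H hx0 hη t)).1

include hδ in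
theorem y_spec (t : ℕ) (i : Fin m) :
    Y t i ∈ dom h ∧ μ * ‖(Y t - argY f h W L (X t) (Λ t)) i‖ ≤ δ t := by
  have hx := hrun.x_mem H hx0 hη t i
  have e : localObj f h W L (X t) (Λ t) i = fun y => (f i (pair (X t i) y) : EReal) - h y
      - ((inner ℝ (dualTerm W L (Λ t) i) y : ℝ) : EReal) := by
    funext y
    rw [localObj, dualTerm, real_inner_smul_left]
    rfl
  -- The infimal distance need not be attained, so a supergradient of norm below `δ t + ε` is taken.
  -- One exists because the distance to the empty set would be `⊤`.
  have key : ∀ ε : ℝ, 0 < ε → Y t i ∈ dom h ∧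
      μ * ‖(Y t - argY f h W L (X t) (Λ t)) i‖ ≤ δ t + ε := by
    intro ε hε
    have hδt := hδ t
    have h1 : Metric.infEDist (0 : Vec n₂)
        (superdifferential (localObj f h W L (X t) (Λ t) i) (Y t i))
        < ENNReal.ofReal (δ t + ε) :=
      lt_of_le_of_lt (hrun.y_step t i)
        ((ENNReal.ofReal_lt_ofReal_iff (by linarith)).2 (by linarith))
    obtain ⟨ξ, hξ, hlt⟩ := Metric.infEDist_lt_iff.1 h1
    rw [e] at hξ
    obtain ⟨hy, hle⟩ := H.rowArg_of_supergradient i hx hξ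
    refine ⟨hy, hle.trans ?_⟩
    rw [edist_dist, ENNReal.ofReal_lt_ofReal_iff (by linarith), dist_zero_left] at hlt
    exact hlt.le
  exact ⟨(key 1 one_pos).1, le_of_forall_pos_le_add fun ε hε => (key ε hε).2⟩

include hδ in
theorem norm_y_sub_le (t : ℕ) :
    ‖Y t - argY f h W L (X t) (Λ t)‖ ≤ √(m : ℝ) * (δ t / μ) := by
  have hμ := H.mu_pos
  have hδt := hδ t
  refine norm_stack_le (by positivity) ?_
  have h1 : ∀ i ∈ Finset.univ, ‖(Y t - argY f h W L (X t) (Λ t)) i‖ ^ 2 ≤ (δ t / μ) ^ 2 := by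
    intro i _
    refine pow_le_pow_left₀ (norm_nonneg _) ?_ 2
    rw [le_div_iff₀ hμ, mul_comm]
    exact (hrun.y_spec H hx0 hη hδ t i).2
  refine (Finset.sum_le_sum h1).trans (le_of_eq ?_)
  rw [mul_pow, Real.sq_sqrt (by positivity)]
  simp

include hW hδ in
theorem norm_y_sub_argY_avg_le (t : ℕ) :
    ‖Y t - argY f h W L (rep m (avg (X t))) (Λ t)‖
      ≤ L / μ * ‖perp (X t)‖ + √(m : ℝ) * (δ t / μ) := by
  have h1 := hrun.norm_y_sub_le H hx0 hη hδ t
  have h2 := H.norm_argY_sub_le hW (hrun.x_mem H hx0 hη t) (X' := rep m (avg (X t)))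
    (fun _ => hrun.avg_mem H hx0 hη t) (Λ t) (Λ t)
  rw [sub_self, norm_zero, mul_zero, add_zero] at h2
  have h3 := norm_sub_le_norm_sub_add_norm_sub (Y t) (argY f h W L (X t) (Λ t))
    (argY f h W L (rep m (avg (X t))) (Λ t))
  change _ ≤ L / μ * ‖X t - rep m (avg (X t))‖ + _
  linarith

include hW hδ in
theorem norm_y_succ_sub_le (t : ℕ) : ‖Y (t + 1) - Y t‖
    ≤ L / μ * (‖X (t + 1) - X t‖ + √(m : ℝ) * ‖Λ (t + 1) - Λ t‖)
      + √(m : ℝ) * (δ t / μ + δ (t + 1) / μ) := by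
  have h1 := hrun.norm_y_sub_le H hx0 hη hδ t
  have h1' := hrun.norm_y_sub_le H hx0 hη hδ (t + 1)
  have h2 := H.norm_argY_sub_le hW (hrun.x_mem H hx0 hη (t + 1)) (hrun.x_mem H hx0 hη t)
    (Λ (t + 1)) (Λ t)
  set P := argY f h W L (X t) (Λ t)
  set P' := argY f h W L (X (t + 1)) (Λ (t + 1))
  have e : Y (t + 1) - Y t = (Y (t + 1) - P') + (P' - P) - (Y t - P) := by abel
  have h3 := norm_sub_le ((Y (t + 1) - P') + (P' - P)) (Y t - P)
  have h4 := norm_add_le (Y (t + 1) - P') (P' - P)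
  rw [e]
  linarith

/-- Proximal steps are nonexpansive, so that they do not increase the distance to a consensus. -/
theorem norm_x_succ_sub_rep_le (t : ℕ) (c : Vec n₁) :
    ‖X (t + 1) - rep m (prox (scale ηx g) c)‖ ≤ ‖matMul W (X t) - ηx • V t - rep m c‖ := by
  refine norm_stack_le (norm_nonneg _) ?_
  rw [norm_sq_stack]
  refine Finset.sum_le_sum fun i _ => pow_le_pow_left₀ (norm_nonneg _) ?_ 2
  rw [PiLp.sub_apply, hrun.x_succ]
  exact prox_scale_nonexpansive H.closed_g ⟨x0, hx0⟩ hη _ _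

include hW in
-- `prox` does not commute with averaging, but `X_⊥` is no longer than the difference of `X` from
-- any consensus. The consensus used is the proximal point of the averaged argument.
theorem norm_perp_x_succ_le (t : ℕ) : ‖perp (X (t + 1))‖
    ≤ rho W * ‖perp (X t)‖ + ηx * ‖perp (V t)‖ := by
  refine le_trans ?_ (hW.norm_perp_sub_smul_le H.pos hη _ _)
  exact (norm_perp_le_norm_sub_rep H.pos _ _).trans
    (hrun.norm_x_succ_sub_rep_le H hx0 hη t (avg (matMul W (X t) - ηx • V t)))

omit hx0 hη in
include hW in
theorem norm_perp_v_succ_le (t : ℕ) : ‖perp (V (t + 1))‖ ≤ rho W * ‖perp (V t)‖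
    + ‖gradStack f (X (t + 1)) (Y (t + 1)) - gradStack f (X t) (Y t)‖ := by
  rw [hrun.v_succ, perp_add]
  refine (norm_add_le _ _).trans (add_le_add (hW.norm_perp_matMul_le H.pos _) ?_)
  exact norm_perp_le H.pos _

include hW hδ in
-- `avg (V t)` averages the local gradients at `(Xᵗ, Yᵗ)`, and `gradPX` those at the consensus point
-- with exact maximizers; only smoothness separates the two.
theorem norm_avg_v_sub_gradPX_le (t : ℕ) :
    √(m : ℝ) * ‖avg (V t) - gradPX f h W L (avg (X t)) (Λ t)‖
      ≤ L * (‖perp (X t)‖ + ‖Y t - argY f h W L (rep m (avg (X t))) (Λ t)‖) := by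
  have hx := hrun.avg_mem H hx0 hη t
  have e : gradPX f h W L (avg (X t)) (Λ t)
      = avg (gradStack f (rep m (avg (X t))) (argY f h W L (rep m (avg (X t))) (Λ t))) := rfl
  rw [hrun.avg_v hW, e, ← avg_sub]
  refine (sqrt_mul_norm_avg_le H.pos _).trans ?_
  exact H.norm_gradStack_sub_le (hrun.x_mem H hx0 hη t) (fun _ => hx)
    (fun i => (hrun.y_spec H hx0 hη hδ t i).1) (H.argY_mem (fun _ => hx) _)

omit hx0 hη in
include hW in
-- The dual update is a gradient descent step for `P` in which `Yᵗ` replaces the exact maximizer.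
theorem norm_gradPL_add_le (hl : 0 < ηl) (t : ℕ) :
    ‖gradPL f h W L (avg (X t)) (Λ t) + (1 / ηl) • (Λ (t + 1) - Λ t)‖
      ≤ L / √(m : ℝ) * ‖Y t - argY f h W L (rep m (avg (X t))) (Λ t)‖ := by
  have hm := H.pos
  have hL := H.L_pos
  have hs : 0 < √(m : ℝ) := by positivity
  have e1 : (1 / ηl) • (Λ (t + 1) - Λ t) = (L / (2 * √(m : ℝ))) • matMul (W - 1) (Y t) := by
    rw [hrun.l_succ_sub, smul_smul]
    congr 1
    field_simp
  rw [e1, gradPL, neg_add_eq_sub, ← smul_sub, ← matMul_sub, norm_smul, Real.norm_eq_abs,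
    abs_of_pos (by positivity)]
  have h1 := mul_le_mul_of_nonneg_left
    (hW.norm_matMul_sub_one_le (Y t - argY f h W L (rep m (avg (X t))) (Λ t)))
    (show 0 ≤ L / (2 * √(m : ℝ)) by positivity)
  refine h1.trans (le_of_eq ?_)
  field_simp

/-- The decrease of `g` along the averaged iterates. -/
theorem g_avg_succ_le (hW : IsMixing G W) (t : ℕ) :
    (g (avg (X (t + 1)))).toReal ≤ (g (avg (X t))).toReal
      - ‖avg (X (t + 1)) - avg (X t)‖ ^ 2 / ηx
      - inner ℝ (avg (V t)) (avg (X (t + 1)) - avg (X t))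
      + ‖perp (matMul W (X t) - ηx • V t)‖ ^ 2 / (4 * ηx * m) := by
  have hm := H.pos
  have hx := hrun.avg_mem H hx0 hη t
  set U := matMul W (X t) - ηx • V t with hU
  have hj := (H.closed_g.jensen hm _ (hrun.x_mem H hx0 hη (t + 1))).2
  -- The variational inequality of each row is tested at the common point `avg (X t)`; the sum is
  -- compared with `g` at the new average by Jensen's inequality.
  have hVI : (inner ℝ (U - X (t + 1)) (rep m (avg (X t)) - X (t + 1)) : ℝ)
      ≤ ηx * (m * (g (avg (X t))).toReal - ∑ i, (g (X (t + 1) i)).toReal) := by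
    have e : (m : ℝ) * (g (avg (X t))).toReal = ∑ _i : Fin m, (g (avg (X t))).toReal := by simp
    rw [inner_stack, e, ← Finset.sum_sub_distrib, Finset.mul_sum]
    refine Finset.sum_le_sum fun i _ => ?_
    have := (prox_scale_spec H.closed_g ⟨x0, hx0⟩ hη (U i)).2 _ hx
    rw [← hrun.x_succ t i] at this
    exact this
  have hj' : (m : ℝ) * (g (avg (X (t + 1)))).toReal ≤ ∑ i, (g (X (t + 1) i)).toReal := by
    have hm' : (0 : ℝ) < m := by positivity
    change (g (avg (X (t + 1)))).toReal ≤ _ at hj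
    rwa [one_div, inv_mul_eq_div, le_div_iff₀ hm', mul_comm] at hj
  rw [inner_stack_decomp hm] at hVI
  have eU : avg U = avg (X t) - ηx • avg (V t) := by
    rw [hU, avg_sub, avg_smul, hW.avg_matMul]
  set Δ := avg (X (t + 1)) - avg (X t) with hΔ
  have e1 : avg (U - X (t + 1)) = -(Δ + ηx • avg (V t)) := by rw [avg_sub, eU, hΔ]; abel
  have e2 : avg (rep m (avg (X t)) - X (t + 1)) = -Δ := by rw [avg_sub, avg_rep hm, hΔ]; abel
  have e3 : perp (rep m (avg (X t)) - X (t + 1)) = -perp (X (t + 1)) := by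
    rw [perp_sub, perp_rep hm, zero_sub]
  rw [e1, e2, e3, inner_neg_neg, inner_neg_right, inner_add_left, real_inner_smul_left,
    real_inner_self_eq_norm_sq, perp_sub, inner_sub_left, real_inner_self_eq_norm_sq] at hVI
  -- The term `‖perp (X (t + 1))‖²` produced by `hVI` absorbs this pairing at the price of `‖perp
  -- U‖²/4`.
  have h4 : (inner ℝ (perp U) (perp (X (t + 1))) : ℝ)
      ≤ ‖perp (X (t + 1))‖ ^ 2 + ‖perp U‖ ^ 2 / 4 := by
    have h5 := real_inner_le_norm (perp U) (perp (X (t + 1)))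
    nlinarith [sq_nonneg (‖perp (X (t + 1))‖ - ‖perp U‖ / 2)]
  have h6 : ηx * m * (g (avg (X (t + 1)))).toReal ≤ ηx * m * ((g (avg (X t))).toReal
      - ‖Δ‖ ^ 2 / ηx - inner ℝ (avg (V t)) Δ + ‖perp U‖ ^ 2 / (4 * ηx * m)) := by
    have e : ηx * m * ((g (avg (X t))).toReal
      - ‖Δ‖ ^ 2 / ηx - inner ℝ (avg (V t)) Δ + ‖perp U‖ ^ 2 / (4 * ηx * m))
      = ηx * m * (g (avg (X t))).toReal - m * ‖Δ‖ ^ 2 - ηx * m * inner ℝ (avg (V t)) Δ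
        + ‖perp U‖ ^ 2 / 4 := by
      field_simp
    rw [e]
    have := mul_le_mul_of_nonneg_left hj' hη.le
    linarith
  exact le_of_mul_le_mul_left h6 (by positivity)

include hW hδ in
/-- The proximal residual at the averaged iterate. -/
theorem norm_sub_prox_le (t : ℕ) :
    √(m : ℝ) * ‖avg (X t) - prox (scale ηx g)
        (avg (X t) - ηx • gradPX f h W L (avg (X t)) (Λ t))‖
      ≤ √(m : ℝ) * ‖avg (X (t + 1)) - avg (X t)‖ + ‖perp (matMul W (X t) - ηx • V t)‖
        + ηx * (L * (‖perp (X t)‖ + ‖Y t - argY f h W L (rep m (avg (X t))) (Λ t)‖)) := by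
  have hm := H.pos
  set c := avg (X t) - ηx • gradPX f h W L (avg (X t)) (Λ t) with hc
  set U := matMul W (X t) - ηx • V t with hU
  have h1 := hrun.norm_x_succ_sub_rep_le H hx0 hη t c
  have h2 := sqrt_mul_norm_avg_le hm (X (t + 1) - rep m (prox (scale ηx g) c))
  rw [avg_sub, avg_rep hm] at h2
  have h3 := hrun.norm_avg_v_sub_gradPX_le H hW hx0 hη hδ t
  -- The deviation from `c` splits into a disagreement part and the tracking error of the average
  -- gradient.
  have e1 : U - rep m c = perp U - rep m (ηx • (avg (V t) - gradPX f h W L (avg (X t)) (Λ t))) := by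
    ext1 i
    simp only [PiLp.sub_apply, rep_apply, perp_apply]
    rw [hU, avg_sub, avg_smul, hW.avg_matMul, hc]
    module
  have e2 : ‖rep m (ηx • (avg (V t) - gradPX f h W L (avg (X t)) (Λ t)))‖
      = ηx * (√(m : ℝ) * ‖avg (V t) - gradPX f h W L (avg (X t)) (Λ t)‖) := by
    rw [← Real.sqrt_sq (norm_nonneg (rep m _)), norm_sq_rep, Real.sqrt_mul (by positivity),
      Real.sqrt_sq (norm_nonneg _), norm_smul, Real.norm_eq_abs, abs_of_pos hη]
    ring
  rw [← hU, e1] at h1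
  have h4 := norm_sub_le (perp U)
    (rep m (ηx • (avg (V t) - gradPX f h W L (avg (X t)) (Λ t))))
  have h5 := norm_sub_le_norm_sub_add_norm_sub (avg (X t)) (avg (X (t + 1))) (prox (scale ηx g) c)
  rw [norm_sub_rev (avg (X t)) (avg (X (t + 1)))] at h5
  have h6 := mul_le_mul_of_nonneg_left h5 (Real.sqrt_nonneg (m : ℝ))
  have h7 := mul_le_mul_of_nonneg_left h3 hη.le
  rw [e2] at h4
  linarith

end IsRun

end Run

/-! ### From a run of the algorithm to the scalar relations. -/

section Main

variable {m n₁ n₂ : ℕ} {f : Fin m → PairVec n₁ n₂ → ℝ} {g : Vec n₁ → EReal} {h : Vec n₂ → EReal}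
  {L μ : ℝ} {Z : Set (PairVec n₁ n₂)} {G : SimpleGraph (Fin m)} {W : Matrix (Fin m) (Fin m) ℝ}
  {x0 : Vec n₁} {ηx ηl : ℝ} {δ : ℕ → ℝ} {X V : ℕ → Stack m n₁} {Λ Y : ℕ → Stack m n₂}

/-- The primal function is a lower bound for `P(·, Λ)`. -/
theorem IsProblem.primal_le_bigP (H : IsProblem f g h L μ Z) (hW : IsMixing G W) (x : Vec n₁)
    (Λ : Stack m n₂) : primal f h x ≤ bigP f h W L x Λ := by
  refine iSup_le fun y => ?_
  by_cases hy : y ∈ dom h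
  -- The consensus competitor `𝟏yᵀ` is annihilated by `W - I`, so the multiplier term vanishes.
  · refine le_trans (le_of_eq ?_) (le_iSup _ (rep m y))
    have hm := H.pos
    rw [bigPhi_eq H _ _ (fun _ => hy), ← H.closed_h.coe_toReal hy]
    simp only [rowObj, Finset.sum_sub_distrib, mul_sub, rep_apply]
    have e := mean_inner_dualTerm (W := W) (L := L) hm Λ (rep m y)
    rw [hW.matMul_sub_one_rep, inner_zero_right, mul_zero] at e
    simp only [rep_apply] at e
    rw [e, ← EReal.coe_sub]
    congr 1
    simp
    field_simp
  · have htop : h y = ⊤ := by simpa [dom] using hy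
    rw [htop, EReal.sub_top]
    exact bot_le

theorem IsProblem.primal_ne_bot (H : IsProblem f g h L μ Z) (x : Vec n₁) :
    primal f h x ≠ ⊥ := by
  obtain ⟨y, hy⟩ := H.nonempty_h
  have h1 : (((1 / (m : ℝ)) * ∑ i, f i (pair x y) - (h y).toReal : ℝ) : EReal)
      ≤ primal f h x := by
    rw [EReal.coe_sub, H.closed_h.coe_toReal hy]
    exact le_iSup (fun y : Vec n₂ =>
      (((1 / (m : ℝ)) * ∑ i, f i (pair x y) : ℝ) : EReal) - h y) y
  exact ne_of_gt (lt_of_lt_of_le (EReal.bot_lt_coe _) h1)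

/-- The optimal value of the primal problem bounds `φ` from below. -/
theorem IsProblem.optimal_value_le (H : IsProblem f g h L μ Z) (hW : IsMixing G W)
    {xstar : Vec n₁} (hxstar : IsMinOn (fun x => primal f h x + g x) Set.univ xstar) {x : Vec n₁}
    (hx : x ∈ dom g) (Λ : Stack m n₂) :
    (primal f h xstar + g xstar).toReal ≤ valP f h W L x Λ + (g x).toReal := by
  have h1 := hxstar (Set.mem_univ x)
  simp only [Set.mem_ofPred_eq] at h1
  have h2 := h1.trans (add_le_add_left (H.primal_le_bigP hW x Λ) (g x))
  rw [H.bigP_eq hx, ← H.closed_g.coe_toReal hx, ← EReal.coe_add] at h2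
  have h3 : primal f h xstar + g xstar ≠ ⊥ :=
    EReal.add_ne_bot_iff.2 ⟨H.primal_ne_bot xstar, H.closed_g.1 xstar⟩
  exact EReal.toReal_le_toReal h2 h3 (EReal.coe_ne_top _)

theorem IsProblem.phi_toReal (H : IsProblem f g h L μ Z) {x : Vec n₁} (hx : x ∈ dom g)
    (Λ : Stack m n₂) : (phi f g h W L x Λ).toReal = valP f h W L x Λ + (g x).toReal := by
  rw [phi, H.bigP_eq hx, ← H.closed_g.coe_toReal hx, ← EReal.coe_add, EReal.toReal_coe,
    EReal.toReal_coe]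

theorem IsRun.norm_sq_diff_le (H : IsProblem f g h L μ Z) (t : ℕ) :
    ‖X (t + 1) - X t‖ ^ 2 ≤ m * (‖avg (X (t + 1)) - avg (X t)‖ ^ 2
      + 2 * (‖perp (X t)‖ / √(m : ℝ)) ^ 2 + 2 * (‖perp (X (t + 1))‖ / √(m : ℝ)) ^ 2) := by
  have hm := H.pos
  have hs : √(m : ℝ) ^ 2 = m := Real.sq_sqrt (by positivity)
  rw [norm_sq_stack_decomp hm, avg_sub, perp_sub, div_pow, div_pow, hs]
  have h1 := pow_le_pow_left₀ (norm_nonneg _) (norm_sub_le (perp (X (t + 1))) (perp (X t))) 2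
  have e : (m : ℝ) * (‖avg (X (t + 1)) - avg (X t)‖ ^ 2 + 2 * (‖perp (X t)‖ ^ 2 / m)
      + 2 * (‖perp (X (t + 1))‖ ^ 2 / m)) = m * ‖avg (X (t + 1)) - avg (X t)‖ ^ 2
      + 2 * ‖perp (X t)‖ ^ 2 + 2 * ‖perp (X (t + 1))‖ ^ 2 := by
    field_simp
  rw [e]
  nlinarith [sq_nonneg (‖perp (X (t + 1))‖ - ‖perp (X t)‖)]

variable (H : IsProblem f g h L μ Z) (hW : IsMixing G W)
  (hrun : IsRun f g h W L x0 ηx ηl δ X Λ Y V) (hx0 : x0 ∈ dom g) (hη : 0 < ηx) (hl : 0 < ηl)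
  (hδ : ∀ t, 0 ≤ δ t)

include H hW hrun hx0 hη hδ

/-- The scaled error of the inexact maximizer. -/
theorem IsRun.scaled_y_error_le (t : ℕ) :
    L / √(m : ℝ) * ‖Y t - argY f h W L (rep m (avg (X t))) (Λ t)‖
      ≤ L * (L / μ) * (‖perp (X t)‖ / √(m : ℝ)) + L / μ * δ t := by
  have hm := H.pos
  have hL := H.L_pos
  have hμ := H.mu_pos
  have hs : 0 < √(m : ℝ) := by positivity
  have h1 := mul_le_mul_of_nonneg_left (hrun.norm_y_sub_argY_avg_le H hW hx0 hη hδ t)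
    (show 0 ≤ L / √(m : ℝ) by positivity)
  refine h1.trans (le_of_eq ?_)
  field_simp

theorem IsRun.gradStack_diff_sq_le (t : ℕ) :
    (‖gradStack f (X (t + 1)) (Y (t + 1)) - gradStack f (X t) (Y t)‖ / √(m : ℝ)) ^ 2
      ≤ L ^ 2 * (1 + 3 * (L / μ) ^ 2) * (‖avg (X (t + 1)) - avg (X t)‖ ^ 2
          + 2 * (‖perp (X t)‖ / √(m : ℝ)) ^ 2 + 2 * (‖perp (X (t + 1))‖ / √(m : ℝ)) ^ 2)
        + 3 * (L * (L / μ)) ^ 2 * ‖Λ (t + 1) - Λ t‖ ^ 2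
        + 6 * ((L / μ * δ t) ^ 2 + (L / μ * δ (t + 1)) ^ 2) := by
  have hm := H.pos
  have hm' : (0 : ℝ) < m := by positivity
  have hL := H.L_pos
  have hμ := H.mu_pos
  have hs : √(m : ℝ) ^ 2 = m := Real.sq_sqrt hm'.le
  have h1 := H.norm_sq_gradStack_sub_le (hrun.x_mem H hx0 hη (t + 1)) (hrun.x_mem H hx0 hη t)
    (fun i => (hrun.y_spec H hx0 hη hδ (t + 1) i).1) (fun i => (hrun.y_spec H hx0 hη hδ t i).1)
  have h2 := hrun.norm_y_succ_sub_le H hW hx0 hη hδ t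
  have h3 := IsRun.norm_sq_diff_le (X := X) H t
  set κ := L / μ with hκ
  set S := ‖avg (X (t + 1)) - avg (X t)‖ ^ 2
    + 2 * (‖perp (X t)‖ / √(m : ℝ)) ^ 2 + 2 * (‖perp (X (t + 1))‖ / √(m : ℝ)) ^ 2
  set x := ‖X (t + 1) - X t‖
  set b := ‖Λ (t + 1) - Λ t‖
  have h4 : ‖Y (t + 1) - Y t‖ ^ 2 ≤ 3 * (κ ^ 2 * x ^ 2) + 3 * (m * (κ ^ 2 * b ^ 2))
      + m * (6 * ((δ t / μ) ^ 2 + (δ (t + 1) / μ) ^ 2)) := by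
    refine (pow_le_pow_left₀ (norm_nonneg _) h2 2).trans ?_
    have three : ∀ x y z : ℝ, (x + y + z) ^ 2 ≤ 3 * x ^ 2 + 3 * y ^ 2 + 3 * z ^ 2 := by
      intro x y z
      nlinarith only [sq_nonneg (x - y), sq_nonneg (x - z), sq_nonneg (y - z)]
    have h5 := three (κ * x) (√(m : ℝ) * (κ * b)) (√(m : ℝ) * (δ t / μ + δ (t + 1) / μ))
    have h6 : (m : ℝ) * (δ t / μ + δ (t + 1) / μ) ^ 2
        ≤ m * (2 * ((δ t / μ) ^ 2 + (δ (t + 1) / μ) ^ 2)) := by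
      gcongr
      nlinarith only [sq_nonneg (δ t / μ - δ (t + 1) / μ)]
    rw [mul_pow κ x, mul_pow √(m : ℝ) (κ * b), mul_pow √(m : ℝ) (δ t / μ + δ (t + 1) / μ), hs,
      mul_pow κ b] at h5
    have e : κ * (x + √(m : ℝ) * b) + √(m : ℝ) * (δ t / μ + δ (t + 1) / μ)
      = κ * x + √(m : ℝ) * (κ * b) + √(m : ℝ) * (δ t / μ + δ (t + 1) / μ) := by ring
    rw [e]
    linarith only [h5, h6]
  rw [div_pow, hs, div_le_iff₀ hm']
  refine h1.trans ?_
  have h7 : L ^ 2 * (x ^ 2 + ‖Y (t + 1) - Y t‖ ^ 2) ≤ L ^ 2 * ((1 + 3 * κ ^ 2) * (m * S)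
      + 3 * (m * (κ ^ 2 * b ^ 2)) + m * (6 * ((δ t / μ) ^ 2 + (δ (t + 1) / μ) ^ 2))) := by
    refine mul_le_mul_of_nonneg_left ?_ (sq_nonneg L)
    have := mul_le_mul_of_nonneg_left h3 (show 0 ≤ 1 + 3 * κ ^ 2 by positivity)
    linarith only [this, h4]
  refine h7.trans (le_of_eq ?_)
  have e : ∀ t, (κ * δ t) ^ 2 = L ^ 2 * (δ t / μ) ^ 2 := by intro t; rw [hκ]; ring
  rw [e, e]
  ring

include hl

/-- The upper quadratic bound for `P` is added to the decrease of `g`. The pairings with the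
gradients of `P` are exchanged for those with `avg (V t)` and the actual dual step, which produces
the negative quadratic terms and the error terms. -/
theorem IsRun.descent (t : ℕ) :
    valP f h W L (avg (X (t + 1))) (Λ (t + 1)) + (g (avg (X (t + 1)))).toReal
      ≤ valP f h W L (avg (X t)) (Λ t) + (g (avg (X t))).toReal
        - ‖avg (X (t + 1)) - avg (X t)‖ ^ 2 / ηx - ‖Λ (t + 1) - Λ t‖ ^ 2 / ηl
        + (L / 2 + L * (L / μ)) * ‖avg (X (t + 1)) - avg (X t)‖ ^ 2
        + L * (L / μ) * ‖Λ (t + 1) - Λ t‖ ^ 2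
        + (L * (‖perp (X t)‖ / √(m : ℝ))
            + (L * (L / μ) * (‖perp (X t)‖ / √(m : ℝ)) + L / μ * δ t))
          * ‖avg (X (t + 1)) - avg (X t)‖
        + (L * (L / μ) * (‖perp (X t)‖ / √(m : ℝ)) + L / μ * δ t) * ‖Λ (t + 1) - Λ t‖
        + (rho W * (‖perp (X t)‖ / √(m : ℝ)) + ηx * (‖perp (V t)‖ / √(m : ℝ))) ^ 2
          / (4 * ηx) := by
  have hm := H.pos
  have hm' : (0 : ℝ) < m := by positivity
  have hs0 : 0 < √(m : ℝ) := by positivity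
  have hs : √(m : ℝ) ^ 2 = m := Real.sq_sqrt hm'.le
  have hxt := hrun.avg_mem H hx0 hη t
  have hxt' := hrun.avg_mem H hx0 hη (t + 1)
  have hup := H.valP_upper hW hxt hxt' (Λ t) (Λ (t + 1))
  have hg := hrun.g_avg_succ_le H hx0 hη hW t
  have herr := IsRun.scaled_y_error_le H hW hrun hx0 hη hδ t
  have hgx := hrun.norm_avg_v_sub_gradPX_le H hW hx0 hη hδ t
  have hgl := hrun.norm_gradPL_add_le H hW hl t
  have hU := hW.norm_perp_sub_smul_le hm hη (X t) (V t)
  set pX := gradPX f h W L (avg (X t)) (Λ t)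
  set pL := gradPL f h W L (avg (X t)) (Λ t)
  set Δ := avg (X (t + 1)) - avg (X t)
  set B := Λ (t + 1) - Λ t
  set N := ‖Y t - argY f h W L (rep m (avg (X t))) (Λ t)‖
  set u := ‖perp (X t)‖ / √(m : ℝ) with hu
  set E := L * (L / μ) * u + L / μ * δ t
  have e1 : L ^ 2 / μ = L * (L / μ) := by ring
  rw [e1] at hup
  have b1 : (inner ℝ pX Δ : ℝ) - inner ℝ (avg (V t)) Δ ≤ (L * u + E) * ‖Δ‖ := by
    rw [← inner_sub_left]
    refine (real_inner_le_norm _ _).trans ?_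
    gcongr
    rw [norm_sub_rev]
    rw [mul_comm, ← le_div_iff₀ hs0] at hgx
    refine hgx.trans ?_
    have e : L * (‖perp (X t)‖ + N) / √(m : ℝ) = L * u + L / √(m : ℝ) * N := by rw [hu]; ring
    rw [e]
    linarith
  have b2 : (inner ℝ pL B : ℝ) ≤ -(‖B‖ ^ 2 / ηl) + E * ‖B‖ := by
    have h1 : (inner ℝ pL B : ℝ) = inner ℝ (pL + (1 / ηl) • B) B - ‖B‖ ^ 2 / ηl := by
      rw [inner_add_left, real_inner_smul_left, real_inner_self_eq_norm_sq]; ring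
    have h2 := real_inner_le_norm (pL + (1 / ηl) • B) B
    have h3 := mul_le_mul_of_nonneg_right (hgl.trans herr) (norm_nonneg B)
    linarith
  have b3 : ‖perp (matMul W (X t) - ηx • V t)‖ ^ 2 / (4 * ηx * m)
      ≤ (rho W * u + ηx * (‖perp (V t)‖ / √(m : ℝ))) ^ 2 / (4 * ηx) := by
    have h1 := pow_le_pow_left₀ (norm_nonneg _) hU 2
    have e : (rho W * u + ηx * (‖perp (V t)‖ / √(m : ℝ))) ^ 2 / (4 * ηx)
        = (rho W * ‖perp (X t)‖ + ηx * ‖perp (V t)‖) ^ 2 / (4 * ηx * m) := by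
      have e0 : rho W * u + ηx * (‖perp (V t)‖ / √(m : ℝ))
          = (rho W * ‖perp (X t)‖ + ηx * ‖perp (V t)‖) / √(m : ℝ) := by rw [hu]; ring
      rw [e0, div_pow, hs]
      field_simp
    rw [e]
    gcongr
  linarith

omit hη hl in
-- Dividing the stacked norms by `√m` removes `m` from all constants; the tolerances are scaled by
-- `κ`, as they enter through `L · δ/μ`.
theorem IsRun.isScalarRun {κ ρ : ℝ} (hκ : κ = L / μ) (hρ : ρ = rho W) (hη : 0 < ηx)
    (hl : 0 < ηl) (hδ' : ∀ t : ℕ, δ t ≤ (1 - ρ) ^ 2 / (8 * κ * (1 + (t : ℝ))))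
    (hV0 : ‖perp (V 0)‖ ^ 2 ≤ 2 * (m : ℝ) * L * κ * (1 - ρ)) {xstar : Vec n₁}
    (hxstar : IsMinOn (fun x => primal f h x + g x) Set.univ xstar) :
    IsScalarRun ρ L κ ηx ηl (primal f h xstar + g xstar).toReal
      (fun t => ‖avg (X (t + 1)) - avg (X t)‖) (fun t => ‖Λ (t + 1) - Λ t‖)
      (fun t => ‖perp (X t)‖ / √(m : ℝ)) (fun t => ‖perp (V t)‖ / √(m : ℝ))
      (fun t => ‖gradStack f (X (t + 1)) (Y (t + 1)) - gradStack f (X t) (Y t)‖ / √(m : ℝ))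
      (fun t => κ * δ t)
      (fun t => valP f h W L (avg (X t)) (Λ t) + (g (avg (X t))).toReal) := by
  have hm := H.pos
  have hm' : (0 : ℝ) < m := by positivity
  have hs0 : 0 < √(m : ℝ) := by positivity
  have hκ0 : 0 < κ := by rw [hκ]; exact div_pos H.L_pos H.mu_pos
  refine ⟨fun _ => norm_nonneg _, fun _ => by positivity,
    fun _ => by positivity, fun t => mul_nonneg hκ0.le (hδ t), fun t => ?_, ?_, fun t => ?_, ?_,
    fun t => ?_, fun t => ?_, fun t => ?_, fun t => ?_⟩
  · have h1 := mul_le_mul_of_nonneg_left (hδ' t) hκ0.le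
    refine h1.trans (le_of_eq ?_)
    field_simp
  · have e : X 0 = rep m x0 := by ext1 i; exact hrun.x_init i
    simp only [e, perp_rep hm, norm_zero, zero_div]
  · have h1 := div_le_div_of_nonneg_right (hrun.norm_perp_x_succ_le H hW hx0 hη t) hs0.le
    rw [← hρ] at h1
    refine h1.trans (le_of_eq ?_)
    ring
  · rw [div_pow, Real.sq_sqrt hm'.le, div_le_iff₀ hm']
    linarith
  · have h1 := div_le_div_of_nonneg_right (hrun.norm_perp_v_succ_le H hW t) hs0.le
    rw [← hρ] at h1
    refine h1.trans (le_of_eq ?_)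
    ring
  · rw [hκ]
    exact IsRun.gradStack_diff_sq_le H hW hrun hx0 hη hδ t
  · rw [hκ, hρ]
    exact IsRun.descent H hW hrun hx0 hη hl hδ t
  · exact H.optimal_value_le hW hxstar (hrun.avg_mem H hx0 hη t) _

omit hl in
theorem IsRun.residual_le (t : ℕ) :
    1 / ηx * ‖avg (X t) - prox (scale ηx g) (avg (X t) - ηx • gradPX f h W L (avg (X t)) (Λ t))‖
      ≤ ‖avg (X (t + 1)) - avg (X t)‖ / ηx
        + (rho W * (‖perp (X t)‖ / √(m : ℝ)) + ηx * (‖perp (V t)‖ / √(m : ℝ))) / ηx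
        + (L * (‖perp (X t)‖ / √(m : ℝ))
          + (L * (L / μ) * (‖perp (X t)‖ / √(m : ℝ)) + L / μ * δ t)) := by
  have hm := H.pos
  have hs0 : 0 < √(m : ℝ) := by positivity
  have h1 := hrun.norm_sub_prox_le H hW hx0 hη hδ t
  have h2 := IsRun.scaled_y_error_le H hW hrun hx0 hη hδ t
  have h3 := hW.norm_perp_sub_smul_le hm hη (X t) (V t)
  set R := ‖avg (X t) - prox (scale ηx g) (avg (X t) - ηx • gradPX f h W L (avg (X t)) (Λ t))‖
  set N := ‖Y t - argY f h W L (rep m (avg (X t))) (Λ t)‖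
  have h4 : √(m : ℝ) * R ≤ √(m : ℝ) * ‖avg (X (t + 1)) - avg (X t)‖
      + (rho W * ‖perp (X t)‖ + ηx * ‖perp (V t)‖) + ηx * (L * (‖perp (X t)‖ + N)) := by
    linarith
  have h5 := mul_le_mul_of_nonneg_left h4 (show 0 ≤ 1 / (ηx * √(m : ℝ)) by positivity)
  have e1 : 1 / (ηx * √(m : ℝ)) * (√(m : ℝ) * R) = 1 / ηx * R := by field_simp
  have e2 : 1 / (ηx * √(m : ℝ)) * (√(m : ℝ) * ‖avg (X (t + 1)) - avg (X t)‖
      + (rho W * ‖perp (X t)‖ + ηx * ‖perp (V t)‖) + ηx * (L * (‖perp (X t)‖ + N)))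
      = ‖avg (X (t + 1)) - avg (X t)‖ / ηx
        + (rho W * (‖perp (X t)‖ / √(m : ℝ)) + ηx * (‖perp (V t)‖ / √(m : ℝ))) / ηx
        + (L * (‖perp (X t)‖ / √(m : ℝ)) + L / √(m : ℝ) * N) := by field_simp
  rw [e1, e2] at h5
  linarith

omit hη in
theorem IsRun.norm_gradPL_le (hη : 0 < ηx) (t : ℕ) :
    ‖gradPL f h W L (avg (X t)) (Λ t)‖ ≤ ‖Λ (t + 1) - Λ t‖ / ηl
      + (L * (L / μ) * (‖perp (X t)‖ / √(m : ℝ)) + L / μ * δ t) := by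
  have h1 := (hrun.norm_gradPL_add_le H hW hl t).trans
    (IsRun.scaled_y_error_le H hW hrun hx0 hη hδ t)
  have h2 := norm_sub_le (gradPL f h W L (avg (X t)) (Λ t) + (1 / ηl) • (Λ (t + 1) - Λ t))
    ((1 / ηl) • (Λ (t + 1) - Λ t))
  rw [add_sub_cancel_right, norm_smul, Real.norm_eq_abs, abs_of_pos (by positivity : 0 < 1 / ηl),
    one_div_mul_eq_div] at h2
  linarith

end Main

end DGDMax

end

theorem mainTheorem1 {m n₁ n₂ : ℕ} (hm : 0 < m)
    -- the agents' network and the mixing matrix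
    (G : SimpleGraph (Fin m)) (hG : G.Connected)
    (W : Matrix (Fin m) (Fin m) ℝ) (hW : DGDMax.IsMixing G W)
    -- the problem
    (f : Fin m → DGDMax.PairVec n₁ n₂ → ℝ)
    (g : DGDMax.Vec n₁ → EReal) (h : DGDMax.Vec n₂ → EReal)
    (hg : DGDMax.IsClosedConvex g) (hh : DGDMax.IsClosedConvex h)
    (hrelint : (intrinsicInterior ℝ (DGDMax.dom h)).Nonempty)
    (L μ : ℝ) (hμ : 0 < μ) (hμL : μ ≤ L)
    (Z : Set (DGDMax.PairVec n₁ n₂)) (hZ : IsOpen Z)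
    (hdomZ : ∀ x ∈ DGDMax.dom g, ∀ y ∈ DGDMax.dom h, DGDMax.pair x y ∈ Z)
    (hsmooth : ∀ i, DGDMax.IsSmoothOn (f i) L Z)
    (hconc : ∀ i, DGDMax.IsStronglyConcaveIn (f i) μ (DGDMax.dom g) (DGDMax.dom h))
    (xstar : DGDMax.Vec n₁)
    (hxstar : IsMinOn (fun x => DGDMax.primal f h x + g x) Set.univ xstar)
    -- the condition number and the spectral quantity of the network
    (κ ρ : ℝ) (hκ : κ = L / μ) (hρ : ρ = DGDMax.rho W)
    -- the run of the algorithm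
    (x0 : DGDMax.Vec n₁) (hx0 : x0 ∈ DGDMax.dom g)
    (δ : ℕ → ℝ) (hδ0 : ∀ t, 0 ≤ δ t)
    (hδ : ∀ t : ℕ, δ t ≤ (1 - ρ) ^ 2 / (8 * κ * (1 + (t : ℝ))))
    (X : ℕ → DGDMax.Stack m n₁) (Λ Y : ℕ → DGDMax.Stack m n₂) (V : ℕ → DGDMax.Stack m n₁)
    (hrun : DGDMax.IsRun f g h W L x0 (DGDMax.stepX ρ L κ) (DGDMax.stepL ρ L κ) δ X Λ Y V)
    (hV0 : ‖DGDMax.perp (V 0)‖ ^ 2 ≤ 2 * (m : ℝ) * L * κ * (1 - ρ))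
    -- the target accuracy and the initial gap
    (ε : ℝ) (hε : 0 < ε)
    (φ₀ : ℝ)
    (hφ₀ : φ₀ = (DGDMax.phi f g h W L (DGDMax.avg (X 0)) (Λ 0)).toReal
      - (DGDMax.primal f h xstar + g xstar).toReal) :
    DGDMax.IsEpsStationaryInExpectation f g h W L (DGDMax.stepX ρ L κ) ε
      (DGDMax.numIter ρ L κ φ₀ ε) X Λ := by
  have hL : 0 < L := hμ.trans_le hμL
  have hκ1 : 1 ≤ κ := by rw [hκ, le_div_iff₀ hμ]; linarith
  have hρ0 : 0 ≤ ρ := by rw [hρ]; exact DGDMax.specNorm_nonneg _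
  have hρ1 : ρ < 1 := by rw [hρ]; exact hW.rho_lt_one
  have H : DGDMax.IsProblem f g h L μ Z :=
    ⟨hm, hg, hh, hrelint.mono intrinsicInterior_subset, hμ, hμL, hdomZ, hsmooth, hconc⟩
  have hη := DGDMax.stepX_pos (κ := κ) hρ1 hL
  have hl := DGDMax.stepL_pos hρ1 hL hκ1
  have hmem := hrun.avg_mem H hx0 hη
  set T := DGDMax.numIter ρ L κ φ₀ ε with hT
  have hsr := DGDMax.IsRun.isScalarRun H hW hrun hx0 hδ0 hκ hρ hη hl hδ hV0 hxstar
  obtain ⟨hb1, hb2, hb3⟩ := hsr.stationarity_bounds hρ0 hρ1 hL hκ1 T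
  rw [H.phi_toReal (hmem 0)] at hφ₀
  simp only [← hφ₀] at hb1 hb2 hb3
  have hε2 : 0 < ε ^ 2 := by positivity
  -- The first entry of the maximum in `T` is exactly the common bound for the three sums of
  -- squares; the entry `800` makes `T` positive.
  have hCT : 64 * (10 * L * κ * (φ₀ + 1) + 1) / (1 - ρ) ^ 2 ≤ T * ε ^ 2 := by
    have h1 := Nat.le_ceil ((1 / ε ^ 2) * max (64 * (10 * L * κ * (φ₀ + 1) + 1) / (1 - ρ) ^ 2)
      (max (4096 * L * κ / (1 - ρ)) 800))
    change _ ≤ (T : ℝ) at h1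
    rw [one_div_mul_eq_div, div_le_iff₀ hε2] at h1
    exact (le_max_left _ _).trans h1
  have hTpos : 0 < T := by
    refine Nat.ceil_pos.2 (mul_pos (by positivity) ?_)
    exact lt_of_lt_of_le (by norm_num : (0 : ℝ) < 800) ((le_max_right _ _).trans (le_max_right _ _))
  refine ⟨fun t _ => ⟨hmem t, ⟨_, H.isGradXP hW (hmem t) _⟩, ⟨_, H.isGradLP hW (hmem t) _⟩⟩,
    fun v hv => ?_, ?_, fun w hw => ?_⟩
  · refine DGDMax.uniformExp_le hTpos hε (fun t ht => ?_) hb1 hCT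
    -- An arbitrary relative gradient `v t` is exchanged for `gradPX`: they differ by a vector
    -- orthogonal to all `z - avg (X t)` with `z ∈ dom g`, which `prox` does not see.
    have e := DGDMax.prox_scale_congr (r := g) hg ⟨x0, hx0⟩ hη (x := DGDMax.avg (X t))
      (u := DGDMax.avg (X t) - DGDMax.stepX ρ L κ • v t)
      (v := DGDMax.avg (X t) - DGDMax.stepX ρ L κ • DGDMax.gradPX f h W L (DGDMax.avg (X t)) (Λ t))
      (fun z hz => by
        have h1 := DGDMax.HasGradientWithinAt.inner_eq hg.convex_dom (hmem t) hz (hv t ht)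
          (H.isGradXP hW (hmem t) (Λ t))
        rw [sub_sub_sub_cancel_left, ← smul_sub, real_inner_smul_left, inner_sub_left, h1, sub_self,
          mul_zero])
    rw [e]
    have h2 := DGDMax.IsRun.residual_le H hW hrun hx0 hη hδ0 t
    rw [← hκ, ← hρ] at h2
    exact h2
  · refine DGDMax.uniformExp_le hTpos hε (fun t _ => le_of_eq ?_) hb2 hCT
    ring
  · refine DGDMax.uniformExp_le hTpos hε (fun t ht => ?_) hb3 hCT
    rw [(hw t ht).unique (H.isGradLP hW (hmem t) (Λ t))]
    have h2 := DGDMax.IsRun.norm_gradPL_le H hW hrun hx0 hl hδ0 hη t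
    rw [← hκ] at h2
    exact h2
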